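/- An \emph{MV-algebra} is an abelian monoid $(A,\oplus,0)$ with a unary operation $\neg$ such that $\neg\neg x=x$, $x\oplus\neg 0=\neg 0$ and $x\oplus\neg(x\oplus\neg y)=y\oplus\neg(y\oplus\neg x)$. The standard MV-algebra $[0,1]$ has $x\oplus y=\min\{x+y,1\}$ and $\neg x=1-x$. An MV-algebra is \emph{simple} if its identity congruence is maximal among its proper congruences, and \emph{semisimple} if it is a subdirect product of a (possibly empty) family of simple MV-algebras. Let $\mathsf{MVS}$ be the category of semisimple MV-algebras and homomorphisms. For finite $n$, a continuous map $f\colon[0,1]^n\to[0,1]$ is \emph{piecewise linear with integer coefficients} if there are finitely many affine functions $f_1,\dots,f_k\colon\mathbb{R}^n\to\mathbb{R}$ with integer coefficients and integer constant terms such that for every $x$ there is $i$ with $f(x)=f_i(x)$. For an arbitrary set $I$, a map $[0,1]^I\to[0,1]$ is piecewise linear with integer coefficients if it factors through the projection to $[0,1]^{I'}$ for some finite $I'\subseteq I$, by such a map on $[0,1]^{I'}$. For $P\subseteq[0,1]^I$ and $Q\subseteq[0,1]^J$, a map $\eta\colon P\to Q$ is a \emph{$\mathbb{Z}$-map} if for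 every $j\in J$ there is a map $\xi_j\colon[0,1]^I\to[0,1]$, piecewise linear with integer coefficients, such that $\eta(p)_j=\xi_j(p)$ for all $p\in P$. Let $\mathsf{T}$ be the category whose objects are the closed subspaces $X\subseteq[0,1]^I$ of Tychonoff cubes ($I$ any set) and whose morphisms are the $\mathbb{Z}$-maps. Let $\mathcal{W}$ be the contravariant functor from MV-algebras to $\mathsf{T}$ given by $\mathcal{W}(A)=\mathrm{Hom}(A,[0,1])\subseteq[0,1]^A$ and $\mathcal{W}(h)(g)=g\circ h$, and let $\mathcal{M}$ be the contravariant functor from $\mathsf{T}$ to MV-algebras which sends $X$ to the algebra of all $\mathbb{Z}$-maps $X\to[0,1]$ with pointwise operations, with $\mathcal{M}(\eta)(\xi)=\xi\circ\eta$. \textbf{Theorem.} Every $\mathcal{M}(X)$ is semisimple, and $\mathcal{M}$ and the restriction of $\mathcal{W}$ to $\mathsf{MVS}$ determine a dual equivalence between $\mathsf{T}$ and $\mathsf{MVS}$. More precisely, the evaluation maps $A\to\mathcal{M}(\mathcal{W}(A))$, $a\mapsto(f\mapsto f(a))$, for $A$ in $\mathsf{MVS}$, and $X\to\mathcal{W}(\mathcal{M}(X))$,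 $x\mapsto(g\mapsto g(x))$, for $X$ in $\mathsf{T}$, are natural isomorphisms in $\mathsf{MVS}$ and in $\mathsf{T}$ respectively, and they are the two units of a contravariant adjunction between these functors. -/

import Mathlib

open CategoryTheory Opposite

universe u v w

namespace MVDuality

/-! ## MV-algebras -/

/-- An MV-algebra: an abelian monoid `(A, ⊕, 0)` with an operation `¬` such that `¬¬x = x`,
`x ⊕ ¬0 = ¬0` and `x ⊕ ¬(x ⊕ ¬y) = y ⊕ ¬(y ⊕ ¬x)`. -/
class MVAlgebra (A : Type u) where
  oplus : A → A → A
  zero : A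
  neg : A → A
  oplus_assoc : ∀ x y z : A, oplus (oplus x y) z = oplus x (oplus y z)
  oplus_comm : ∀ x y : A, oplus x y = oplus y x
  oplus_zero : ∀ x : A, oplus x zero = x
  neg_neg : ∀ x : A, neg (neg x) = x
  oplus_neg_zero : ∀ x : A, oplus x (neg zero) = neg zero
  lukasiewicz : ∀ x y : A,
    oplus x (neg (oplus x (neg y))) = oplus y (neg (oplus y (neg x)))

open MVAlgebra

/-- Truncated addition `min (x + y) 1` on `[0,1]`. -/
def truncAdd (x y : unitInterval) : unitInterval :=
  ⟨min ((x : ℝ) + y) 1, le_min (add_nonneg x.2.1 y.2.1) zero_le_one, min_le_right _ _⟩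

/-- The standard MV-algebra on `[0,1]`: `x ⊕ y = min (x + y) 1`, `¬x = 1 - x`. -/
instance standardMVAlgebra : MVAlgebra unitInterval where
  oplus := truncAdd
  zero := 0
  neg := unitInterval.symm
  oplus_assoc x y z := by
    have hx := x.2.1
    have hz := z.2.1
    apply Subtype.ext
    simp only [truncAdd]
    rcases le_total ((x : ℝ) + y) 1 with h | h <;> rcases le_total ((y : ℝ) + z) 1 with h' | h' <;>
      simp only [h, h', min_eq_left, min_eq_right, add_assoc]
    · rw [min_eq_right (by linarith), min_eq_right (by linarith)]
    · rw [min_eq_right (by linarith), min_eq_right (by linarith)]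
    · rw [min_eq_right (by linarith), min_eq_right (by linarith)]
  oplus_comm x y := by
    apply Subtype.ext
    simp only [truncAdd, add_comm]
  oplus_zero x := by
    apply Subtype.ext
    simpa [truncAdd] using x.2.2
  neg_neg x := unitInterval.symm_symm x
  oplus_neg_zero x := by
    apply Subtype.ext
    simpa [truncAdd] using x.2.1
  lukasiewicz x y := by
    have hx := x.2
    have hy := y.2
    apply Subtype.ext
    simp only [truncAdd, unitInterval.coe_symm_eq]
    rcases le_total (x : ℝ) y with h | h
    · rw [min_eq_left (a := (x : ℝ) + (1 - y)) (by linarith),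
        min_eq_right (a := (y : ℝ) + (1 - x)) (by linarith)]
      congr 1
      ring
    · rw [min_eq_right (a := (x : ℝ) + (1 - y)) (by linarith),
        min_eq_left (a := (y : ℝ) + (1 - x)) (by linarith)]
      congr 1
      ring

/-- Homomorphisms of MV-algebras. -/
structure IsMVHom {A : Type u} {B : Type v} [MVAlgebra A] [MVAlgebra B] (f : A → B) : Prop where
  map_zero : f zero = zero
  map_oplus : ∀ x y, f (oplus x y) = oplus (f x) (f y)
  map_neg : ∀ x, f (neg x) = neg (f x)

theorem IsMVHom.comp {A : Type u} {B : Type v} {C : Type w} [MVAlgebra A] [MVAlgebra B]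
    [MVAlgebra C] {g : B → C} {f : A → B} (hg : IsMVHom g) (hf : IsMVHom f) :
    IsMVHom (g ∘ f) where
  map_zero := by simp [hf.map_zero, hg.map_zero]
  map_oplus x y := by simp [hf.map_oplus, hg.map_oplus]
  map_neg x := by simp [hf.map_neg, hg.map_neg]

/-- Congruences of an MV-algebra: equivalence relations compatible with the operations. -/
structure MVCongruence (A : Type u) [MVAlgebra A] extends Setoid A where
  oplus_congr : ∀ {x x' y y' : A}, r x x' → r y y' → r (oplus x y) (oplus x' y')
  neg_congr : ∀ {x x' : A}, r x x' → r (neg x) (neg x')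

/-- Congruences are ordered by inclusion. -/
instance (A : Type u) [MVAlgebra A] : LE (MVCongruence A) where
  le θ φ := ∀ x y, θ.r x y → φ.r x y

/-- A congruence is proper if it does not identify all elements. -/
def MVCongruence.IsProper {A : Type u} [MVAlgebra A] (θ : MVCongruence A) : Prop :=
  ∃ x y, ¬ θ.r x y

/-- The identity congruence. -/
def idCongruence (A : Type u) [MVAlgebra A] : MVCongruence A where
  r x y := x = y
  iseqv := eq_equivalence
  oplus_congr := by rintro _ _ _ _ rfl rfl; rfl
  neg_congr := by rintro _ _ rfl; rfl

/-- An MV-algebra is simple if the identity is maximal in the poset of proper congruences. -/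
def IsSimpleMV (A : Type u) [MVAlgebra A] : Prop :=
  Maximal MVCongruence.IsProper (idCongruence A)

/-- An MV-algebra is semisimple if it is a subdirect product of simple MV-algebras: it embeds
into the product of a (possibly empty) family of simple MV-algebras, by a map all of whose
components are surjective homomorphisms. -/
def IsSemisimpleMV (A : Type u) [MVAlgebra A] : Prop :=
  ∃ (ι : Type u) (S : ι → Type u) (_ : ∀ i, MVAlgebra (S i)) (h : ∀ i, A → S i),
    (∀ i, IsSimpleMV (S i)) ∧ (∀ i, IsMVHom (h i)) ∧ (∀ i, Function.Surjective (h i)) ∧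
      Function.Injective (fun (a : A) (i : ι) => h i a)

/-- The category `MV` of MV-algebras and homomorphisms. -/
structure MVAlg where
  carrier : Type u
  [str : MVAlgebra carrier]

attribute [instance] MVAlg.str

/-- Morphisms of `MV`. -/
@[ext]
structure MVAlg.Hom (A B : MVAlg.{u}) where
  toFun : A.carrier → B.carrier
  isHom : IsMVHom toFun

instance : Category.{u} MVAlg.{u} where
  Hom A B := MVAlg.Hom A B
  id A := ⟨id, ⟨rfl, fun _ _ => rfl, fun _ => rfl⟩⟩
  comp f g := ⟨g.toFun ∘ f.toFun, g.isHom.comp f.isHom⟩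

/-- Semisimplicity as a property of objects of `MV`. -/
def semisimple : ObjectProperty MVAlg.{u} := fun A => IsSemisimpleMV A.carrier

/-- The full subcategory of semisimple MV-algebras. -/
abbrev MVS := (semisimple.{u}).FullSubcategory

/-! ## Piecewise linear maps with integer coefficients and `ℤ`-maps -/

/-- For a finite index set `n`: a continuous map `f : [0,1]^n → [0,1]` is piecewise linear with
integer coefficients if there are finitely many affine functions `x ↦ c + ∑ i, m i * x i` with
`c` and all `m i` integers such that `f` agrees at each point with one of them. -/
def IsIntPLFin {n : Type v} [Fintype n] (f : (n → unitInterval) → unitInterval) : Prop :=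
  Continuous f ∧ ∃ F : Set (ℤ × (n → ℤ)), F.Finite ∧
    ∀ x, ∃ q ∈ F, (f x : ℝ) = (q.1 : ℝ) + ∑ i, (q.2 i : ℝ) * (x i : ℝ)

/-- For an arbitrary index set `I`: a map `f : [0,1]^I → [0,1]` is piecewise linear with integer
coefficients if it factors through the projection to a finite subset `s` of coordinates, by a
piecewise linear map with integer coefficients on `[0,1]^s`. -/
def IsIntPL {I : Type v} (f : (I → unitInterval) → unitInterval) : Prop :=
  ∃ (s : Finset I) (g : (s → unitInterval) → unitInterval),
    IsIntPLFin g ∧ ∀ p, f p = g (fun i => p i)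

/-- `ℤ`-maps from `P ⊆ [0,1]^I` to `[0,1]`. -/
def IsZFun {I : Type v} {P : Set (I → unitInterval)} (ξ : P → unitInterval) : Prop :=
  ∃ f : (I → unitInterval) → unitInterval, IsIntPL f ∧ ∀ p : P, ξ p = f p

/-- `ℤ`-maps from `P ⊆ [0,1]^I` to `Q ⊆ [0,1]^J`. -/
def IsZMap {I : Type v} {J : Type w} {P : Set (I → unitInterval)} {Q : Set (J → unitInterval)}
    (η : P → Q) : Prop :=
  ∀ j, IsZFun (fun p => (η p : J → unitInterval) j)

theorem isIntPL_proj {I : Type v} (i : I) : IsIntPL (fun p : I → unitInterval => p i) := by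
  classical
  refine ⟨{i}, fun x => x ⟨i, by simp⟩, ⟨continuous_apply _, {(0, fun _ => 1)}, by simp, ?_⟩, ?_⟩
  · intro x
    refine ⟨_, rfl, ?_⟩
    rw [Fintype.sum_eq_single ⟨i, by simp⟩]
    · simp
    · rintro ⟨j, hj⟩ h
      exact absurd (Subtype.ext (by simpa using hj)) h
  · intro p
    rfl

theorem IsIntPL.comp {I : Type v} {J : Type w} {f : (J → unitInterval) → unitInterval}
    (hf : IsIntPL f) {g : J → (I → unitInterval) → unitInterval} (hg : ∀ j, IsIntPL (g j)) :
    IsIntPL (fun p => f (fun j => g j p)) := by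
  classical
  obtain ⟨t, f', ⟨hfc, F, hF, hfF⟩, hff⟩ := hf
  choose s g' hg' hgg using hg
  choose hgc G hG hgG using hg'
  let U : Finset I := t.biUnion s
  have hU : ∀ j : t, ∀ i : s j, (i : I) ∈ U := fun j i =>
    Finset.mem_biUnion.2 ⟨j, j.2, i.2⟩
  let res (j : t) (x : U → unitInterval) : s j → unitInterval := fun i => x ⟨i, hU j i⟩
  let ext (j : t) (m : s j → ℤ) : U → ℤ := fun i => if h : (i : I) ∈ s j then m ⟨i, h⟩ else 0
  have hext : ∀ (j : t) (m : s j → ℤ) (x : U → unitInterval),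
      ∑ i, (ext j m i : ℝ) * (x i : ℝ) = ∑ i, (m i : ℝ) * (res j x i : ℝ) := by
    intro j m x
    symm
    refine Fintype.sum_of_injective (fun i : s j => (⟨i, hU j i⟩ : U)) ?_ _ _ ?_ ?_
    · intro a b h
      exact Subtype.ext (congrArg (fun z : U => (z : I)) h)
    · intro i hi
      have : (i : I) ∉ s j := fun h => hi ⟨⟨i, h⟩, rfl⟩
      simp [ext, this]
    · intro i
      simp [ext, res]
  refine ⟨U, fun x => f' (fun j => g' j (res j x)), ⟨?_, ?_⟩, ?_⟩
  · refine hfc.comp (continuous_pi fun j => (hgc j).comp (continuous_pi fun i => ?_))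
    exact continuous_apply _
  · let comb (z : (ℤ × (t → ℤ)) × (∀ j : t, ℤ × (s j → ℤ))) : ℤ × (U → ℤ) :=
      (z.1.1 + ∑ j, z.1.2 j * (z.2 j).1, fun i => ∑ j, z.1.2 j * ext j (z.2 j).2 i)
    refine ⟨comb '' (F ×ˢ Set.univ.pi fun j : t => G j),
      (hF.prod (Set.Finite.pi' fun j : t => hG j) |>.subset ?_).image _, ?_⟩
    · rintro ⟨a, b⟩ ⟨ha, hb⟩
      exact ⟨ha, fun j => hb j (Set.mem_univ j)⟩
    · intro x
      obtain ⟨a, ha, hax⟩ := hfF (fun j => g' j (res j x))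
      choose b hb hbx using fun j : t => hgG j (res j x)
      refine ⟨comb (a, b), ⟨(a, b), ⟨ha, fun j _ => hb j⟩, rfl⟩, ?_⟩
      rw [hax]
      simp only [comb]
      push_cast
      simp only [hbx, Finset.sum_mul, ← hext]
      rw [Finset.sum_comm, add_assoc, ← Finset.sum_add_distrib]
      simp only [mul_add, Finset.mul_sum, mul_assoc]
  · intro p
    simp only [hff, hgg]
    rfl

theorem isIntPL_zero {I : Type v} : IsIntPL (fun _ : I → unitInterval => 0) :=
  ⟨∅, fun _ => 0, ⟨continuous_const, {(0, fun _ => 0)}, by simp, fun _ => ⟨_, rfl, by simp⟩⟩,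
    fun _ => rfl⟩

theorem isIntPL_symm :
    IsIntPL (fun p : Unit → unitInterval => unitInterval.symm (p ())) := by
  refine ⟨Finset.univ, fun x => unitInterval.symm (x ⟨(), by simp⟩), ⟨?_, {(1, fun _ => -1)},
    by simp, ?_⟩, fun _ => rfl⟩
  · exact unitInterval.continuous_symm.comp (continuous_apply _)
  · intro x
    refine ⟨_, rfl, ?_⟩
    rw [Fintype.sum_eq_single ⟨(), by simp⟩]
    · simp [sub_eq_add_neg]
    · rintro ⟨j, hj⟩ h
      exact absurd rfl h

theorem continuous_truncAdd {X : Type v} [TopologicalSpace X] {f g : X → unitInterval}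
    (hf : Continuous f) (hg : Continuous g) : Continuous (fun x => truncAdd (f x) (g x)) := by
  unfold truncAdd
  fun_prop

theorem isIntPL_truncAdd :
    IsIntPL (fun p : Bool → unitInterval => truncAdd (p true) (p false)) := by
  refine ⟨Finset.univ, fun x => truncAdd (x ⟨true, by simp⟩) (x ⟨false, by simp⟩),
    ⟨?_, {(0, fun _ => 1), (1, fun _ => 0)}, Set.toFinite _, ?_⟩, fun _ => rfl⟩
  · exact continuous_truncAdd (by fun_prop) (by fun_prop)
  · intro x
    have hsum : ∑ i, (x i : ℝ) = x ⟨true, by simp⟩ + x ⟨false, by simp⟩ := by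
      rw [← Fintype.sum_bool (fun b => (x ⟨b, by simp⟩ : ℝ))]
      exact Fintype.sum_equiv (Equiv.subtypeUnivEquiv (fun b => Finset.mem_univ b)) _ _
        (fun _ => rfl)
    rcases le_total ((x ⟨true, by simp⟩ : ℝ) + x ⟨false, by simp⟩) 1 with h | h
    · refine ⟨_, Or.inl rfl, ?_⟩
      simp only [truncAdd, min_eq_left h, Int.cast_zero, Int.cast_one, one_mul, zero_add]
      exact hsum.symm
    · refine ⟨_, Or.inr rfl, ?_⟩
      simp only [truncAdd, min_eq_right h, Int.cast_zero, Int.cast_one, zero_mul,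
        Finset.sum_const_zero, add_zero]

section ZFun

variable {I : Type v} {P : Set (I → unitInterval)}

theorem isZFun_proj (i : I) : IsZFun (fun p : P => (p : I → unitInterval) i) :=
  ⟨_, isIntPL_proj i, fun _ => rfl⟩

theorem isZFun_zero : IsZFun (fun _ : P => 0) :=
  ⟨_, isIntPL_zero, fun _ => rfl⟩

theorem IsZFun.symm {ξ : P → unitInterval} (h : IsZFun ξ) :
    IsZFun (fun p => unitInterval.symm (ξ p)) := by
  obtain ⟨f, hf, h⟩ := h
  exact ⟨_, isIntPL_symm.comp (g := fun _ => f) fun _ => hf, fun p => by simp only [h]⟩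

theorem IsZFun.truncAdd {ξ ζ : P → unitInterval} (hξ : IsZFun ξ) (hζ : IsZFun ζ) :
    IsZFun (fun p => truncAdd (ξ p) (ζ p)) := by
  obtain ⟨f, hf, hξ⟩ := hξ
  obtain ⟨g, hg, hζ⟩ := hζ
  exact ⟨_, isIntPL_truncAdd.comp (g := fun b => cond b f g) (by rintro (_ | _) <;> assumption),
    fun p => by simp only [hξ, hζ, cond_true, cond_false]⟩

theorem IsZFun.comp {J : Type w} {Q : Set (J → unitInterval)} {ξ : Q → unitInterval}
    (hξ : IsZFun ξ) {η : P → Q} (hη : IsZMap η) : IsZFun (ξ ∘ η) := by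
  obtain ⟨f, hf, h⟩ := hξ
  choose g hg hgη using hη
  refine ⟨_, hf.comp hg, fun p => ?_⟩
  rw [Function.comp_apply, h]
  congr 1
  funext j
  exact hgη j p

end ZFun

/-! ## Closed subspaces of Tychonoff cubes -/

/-- Objects of the category `T`: closed subspaces of Tychonoff cubes `[0,1]^I`. -/
structure TychSub where
  index : Type u
  space : Set (index → unitInterval)
  isClosed : IsClosed space

/-- Morphisms of `T`: `ℤ`-maps. -/
@[ext]
structure TychSub.Hom (X Y : TychSub.{u}) where
  toFun : X.space → Y.space
  isZMap : IsZMap toFun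

instance : Category.{u} TychSub.{u} where
  Hom X Y := TychSub.Hom X Y
  id X := ⟨id, fun j => isZFun_proj j⟩
  comp f g := ⟨g.toFun ∘ f.toFun, fun j => (g.isZMap j).comp f.isZMap⟩

/-! ## The functors -/

/-- The set `Hom(A,[0,1])`, as a subset of the cube `[0,1]^A`. -/
def homSet (A : Type u) [MVAlgebra A] : Set (A → unitInterval) :=
  {p | IsMVHom p}

theorem isClosed_homSet (A : Type u) [MVAlgebra A] : IsClosed (homSet A) := by
  have h : homSet A = {p | p zero = 0} ∩
      ((⋂ (x : A) (y : A), {p | p (oplus x y) = truncAdd (p x) (p y)}) ∩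
        ⋂ x : A, {p | p (neg x) = unitInterval.symm (p x)}) := by
    ext p
    simp only [Set.mem_inter_iff, Set.mem_iInter, homSet, Set.mem_ofPred_eq]
    exact ⟨fun h => ⟨h.1, h.2, h.3⟩, fun h => ⟨h.1, h.2.1, h.2.2⟩⟩
  rw [h]
  refine (isClosed_eq (by fun_prop) (by fun_prop)).inter
    ((isClosed_iInter fun x => isClosed_iInter fun y => isClosed_eq (by fun_prop)
      (continuous_truncAdd (by fun_prop) (by fun_prop))).inter
    (isClosed_iInter fun x => isClosed_eq (by fun_prop)
      (unitInterval.continuous_symm.comp (by fun_prop))))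

/-- The contravariant functor `W` from MV-algebras to closed subspaces of Tychonoff cubes:
`W(A) = Hom(A,[0,1]) ⊆ [0,1]^A` and `W(h)(g) = g ∘ h`. -/
def W : MVAlg.{u} ⥤ TychSub.{u}ᵒᵖ where
  obj A := op ⟨A.carrier, homSet A.carrier, isClosed_homSet A.carrier⟩
  map {A B} h := Quiver.Hom.op (X := (⟨B.carrier, homSet B.carrier, isClosed_homSet _⟩ : TychSub))
    (Y := ⟨A.carrier, homSet A.carrier, isClosed_homSet _⟩)
    ⟨fun g => ⟨g.1 ∘ h.toFun, IsMVHom.comp g.2 h.isHom⟩, fun a => isZFun_proj (h.toFun a)⟩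

/-- The `ℤ`-maps `X → [0,1]` form an MV-algebra under pointwise operations. -/
instance zFunMVAlgebra {I : Type v} (X : Set (I → unitInterval)) :
    MVAlgebra {ξ : X → unitInterval // IsZFun ξ} where
  oplus ξ ζ := ⟨fun p => oplus (ξ.1 p) (ζ.1 p), ξ.2.truncAdd ζ.2⟩
  zero := ⟨fun _ => zero, isZFun_zero⟩
  neg ξ := ⟨fun p => neg (ξ.1 p), ξ.2.symm⟩
  oplus_assoc _ _ _ := Subtype.ext (funext fun _ => oplus_assoc _ _ _)
  oplus_comm _ _ := Subtype.ext (funext fun _ => oplus_comm _ _)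
  oplus_zero _ := Subtype.ext (funext fun _ => oplus_zero _)
  neg_neg _ := Subtype.ext (funext fun _ => neg_neg _)
  oplus_neg_zero _ := Subtype.ext (funext fun _ => oplus_neg_zero _)
  lukasiewicz _ _ := Subtype.ext (funext fun _ => lukasiewicz _ _)

/-- The contravariant functor `McN` from closed subspaces of Tychonoff cubes to MV-algebras:
`McN(X)` is the algebra of `ℤ`-maps `X → [0,1]` and `McN(η)(ξ) = ξ ∘ η`. -/
def McN : TychSub.{u}ᵒᵖ ⥤ MVAlg.{u} where
  obj X := ⟨{ξ : X.unop.space → unitInterval // IsZFun ξ}⟩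
  map {X Y} η := ⟨fun ξ => ⟨ξ.1 ∘ (Quiver.Hom.unop η).toFun, ξ.2.comp (Quiver.Hom.unop η).isZMap⟩,
    ⟨rfl, fun _ _ => rfl, fun _ => rfl⟩⟩

/-- The restriction of `W` to semisimple MV-algebras. -/
abbrev WS : MVS.{u} ⥤ TychSub.{u}ᵒᵖ := semisimple.ι ⋙ W

/-- The functor `McN` corestricted to semisimple MV-algebras, given that it takes values there. -/
abbrev McNS (hM : ∀ X : TychSub.{u}ᵒᵖ, semisimple (McN.obj X)) : TychSub.{u}ᵒᵖ ⥤ MVS.{u} :=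
  semisimple.lift McN hM

end MVDuality

open MVDuality

/-! The two evaluation maps satisfy the triangle identities by definition, so they give an
adjunction; what remains is that both are invertible. Two facts carry this.

Hölder for simple algebras: a simple MV-algebra maps to `[0,1]`. Simplicity makes some multiple of
each nonzero element reach the top, and prelinearity then makes the natural order total. The Chang
group of such a chain is an archimedean ordered group with unit, hence embeds in `ℝ` with the unit
sent to `1` (`IsSimpleMV.exists_hom`). So homomorphisms to `[0,1]` separate the points of a
semisimple algebra, and `A → M(W(A))` is injective.

McNaughton: a set of `[0,1]`-valued functions closed under the MV-operations is closed under
composition with piecewise linear maps with integer coefficients (`IsMVClosed.of_isIntPL`). Such a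
map is a finite maximum of minima of truncated integer affine functions, and these are built one
summand at a time by `clamp_add`. Applied to the functions on `W(A)` represented by elements of `A`,
it gives surjectivity of `A → M(W(A))`. Applied to a homomorphism `φ` on `M(X)`, it shows that `φ`
is evaluation at the point `p` of its values on the coordinates (`hom_apply_eq`). Since `X` is
closed, a bump function that vanishes on `X` but not at `p` would contradict this if `p ∉ X`, so `X
→ W(M(X))` is bijective; its inverse has coordinate projections as components. -/

namespace MVDuality

open MVAlgebra

/-! ### Arithmetic and natural order of an MV-algebra -/

section Order

variable {A : Type u} [MVAlgebra A]

theorem neg_oplus_self (x : A) : oplus (neg x) x = neg zero := by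
  have h := lukasiewicz x (neg zero)
  rw [MVAlgebra.neg_neg, oplus_zero, oplus_comm (neg zero), oplus_comm (neg zero), oplus_neg_zero,
    oplus_comm] at h
  exact h

variable (A) in
/-- The additive monoid underlying an MV-algebra. -/
abbrev mvAddCommMonoid : AddCommMonoid A where
  add := oplus
  zero := MVAlgebra.zero
  add_assoc := oplus_assoc
  add_comm := oplus_comm
  add_zero := oplus_zero
  zero_add x := (oplus_comm _ _).trans (oplus_zero x)
  nsmul := @nsmulRec A ⟨zero⟩ ⟨oplus⟩
  nsmul_zero _ := rfl
  nsmul_succ _ _ := rfl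

attribute [local instance] mvAddCommMonoid

theorem oplus_eq_add (x y : A) : oplus x y = x + y := rfl

theorem mv_neg_neg (x : A) : neg (neg x) = x := MVAlgebra.neg_neg x

theorem add_neg_zero (x : A) : x + neg 0 = neg 0 := oplus_neg_zero x

theorem neg_zero_add (x : A) : neg 0 + x = neg 0 := by rw [add_comm, add_neg_zero]

theorem mv_neg_inj {x y : A} : neg x = neg y ↔ x = y :=
  ⟨fun h => by rw [← mv_neg_neg x, h, mv_neg_neg], fun h => h ▸ rfl⟩

variable (A) in
/-- Truncated subtraction in an MV-algebra. -/
abbrev mvSub : Sub A where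
  sub x y := neg (neg x + y)

attribute [local instance] mvSub

theorem mv_sub_def (x y : A) : x - y = neg (neg x + y) := rfl

theorem neg_add_eq_sub (x y : A) : neg (x + y) = neg x - y := by
  rw [mv_sub_def, mv_neg_neg]

theorem neg_mv_sub (x y : A) : neg (x - y) = neg x + y := by
  rw [mv_sub_def, mv_neg_neg]

/-- The Łukasiewicz axiom in terms of subtraction: both sides are the join of `x` and `y`. -/
theorem mv_sub_add_comm (x y : A) : x - y + y = y - x + x := by
  have h := lukasiewicz y x
  rw [mv_sub_def, mv_sub_def, add_comm, add_comm _ x, add_comm (neg x), add_comm (neg y)]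
  exact h

theorem mv_neg_sub_neg (x y : A) : neg x - neg y = y - x := by
  rw [mv_sub_def, mv_sub_def, mv_neg_neg, add_comm]

theorem sub_eq_zero_iff_neg_add {x y : A} : x - y = 0 ↔ neg x + y = neg 0 := by
  rw [mv_sub_def, ← mv_neg_inj, mv_neg_neg]

variable (A) in
/-- The natural order of an MV-algebra. -/
abbrev mvPartialOrder : PartialOrder A where
  le x y := neg x + y = neg 0
  le_refl := neg_oplus_self
  le_trans x y z hxy hyz := by
    rw [← sub_eq_zero_iff_neg_add] at hxy hyz
    have h := mv_sub_add_comm x y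
    have h' := mv_sub_add_comm y z
    rw [hxy, zero_add] at h
    rw [hyz, zero_add] at h'
    -- When `x ≤ y`, the join is `y = x + (y - x)`; chaining two such decompositions exhibits `z` as
    -- `x` plus something.
    have k : z = x + (y - x + (z - y)) := by
      rw [← add_assoc, add_comm x, ← h, add_comm, ← h']
    rw [k, ← add_assoc, show neg x + x = neg 0 from neg_oplus_self x, neg_zero_add]
  le_antisymm x y hxy hyx := by
    rw [← sub_eq_zero_iff_neg_add] at hxy hyx
    have := mv_sub_add_comm x y
    rw [hxy, hyx, zero_add, zero_add] at this
    exact this.symm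

attribute [local instance] mvPartialOrder

theorem mv_le_def {x y : A} : x ≤ y ↔ neg x + y = neg 0 := Iff.rfl

theorem mv_le_iff_sub {x y : A} : x ≤ y ↔ x - y = 0 := sub_eq_zero_iff_neg_add.symm

theorem mv_le_neg_zero (x : A) : x ≤ neg 0 := add_neg_zero (neg x)

theorem mv_zero_le (x : A) : 0 ≤ x := neg_zero_add x

theorem mv_neg_le_iff {x y : A} : neg x ≤ y ↔ x + y = neg 0 := by
  rw [mv_le_def, mv_neg_neg]

theorem mv_le_neg_comm {x y : A} : x ≤ neg y ↔ y ≤ neg x := by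
  rw [mv_le_def, mv_le_def, add_comm]

/-- Residuation: both sides unfold to the same equation. -/
theorem mv_sub_le_iff {x y z : A} : x - y ≤ z ↔ x ≤ z + y := by
  rw [mv_le_def, mv_le_def, neg_mv_sub, add_assoc, add_comm y]

theorem mv_sub_add_cancel {x y : A} (h : y ≤ x) : x - y + y = x := by
  rw [mv_sub_add_comm, mv_le_iff_sub.1 h, zero_add]

theorem mv_le_add_right (x y : A) : x ≤ x + y := by
  rw [mv_le_def, ← add_assoc, show neg x + x = neg 0 from neg_oplus_self x, neg_zero_add]

theorem mv_add_le_add_left {x y : A} (h : x ≤ y) (z : A) : x + z ≤ y + z := by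
  rw [← mv_sub_add_cancel h, add_comm (y - x), add_assoc, add_comm (y - x), ← add_assoc]
  exact mv_le_add_right (x + z) (y - x)

theorem mv_sub_neg_comm (x y : A) : x - neg y = y - neg x := by
  rw [mv_sub_def, mv_sub_def, add_comm]

theorem mv_sub_le_sub_left {x y : A} (h : x ≤ y) (z : A) : z - y ≤ z - x :=
  mv_sub_le_iff.2 ((mv_sub_le_iff.1 le_rfl).trans
    (by rw [add_comm, add_comm _ y]; exact mv_add_le_add_left h _))

theorem mv_sub_le_self (x y : A) : x - y ≤ x :=
  mv_sub_le_iff.2 (mv_le_add_right x y)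

theorem mv_sub_add_eq (x y z : A) : x - (y + z) = x - y - z := by
  rw [mv_sub_def, mv_sub_def, neg_mv_sub, add_assoc]

theorem mv_add_sub_cancel {x y : A} (h : x ≤ neg y) : x + y - y = x := by
  rw [← mv_neg_inj, neg_mv_sub, neg_add_eq_sub, mv_sub_add_cancel (mv_le_neg_comm.1 h)]

theorem mv_sub_le_neg (x y : A) : x - y ≤ neg y := by
  rw [mv_le_neg_comm, neg_mv_sub, add_comm]
  exact mv_le_add_right y _

theorem mv_sub_sub_cancel {x y : A} (h : y ≤ x) : x - (x - y) = y := by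
  have := mv_add_sub_cancel (mv_le_neg_comm.1 (mv_sub_le_neg x y))
  rwa [add_comm, mv_sub_add_cancel h] at this

/-- Associativity of partial sums: `(a ⊕ b) ⊙ c = a ⊙ (b ⊕ c)` if `a ⊙ b = b ⊙ c = 0`. -/
theorem add_sub_neg_assoc {a b c : A} (hab : a ≤ neg b) (hbc : b ≤ neg c) :
    a + b - neg c = a - neg (b + c) := by
  conv_lhs => rw [← mv_sub_add_cancel hbc, ← neg_add_eq_sub, add_comm c, add_comm (neg _),
    mv_sub_add_eq, mv_add_sub_cancel hab]

/-- The dual of `add_sub_neg_assoc`. -/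
theorem sub_neg_add_assoc {a b c : A} (hab : a + b = neg 0) (hbc : b + c = neg 0) :
    a - neg b + c = a + (b - neg c) := by
  have h := add_sub_neg_assoc (a := neg a) (b := neg b) (c := neg c)
    (mv_neg_le_iff.2 (by rwa [mv_neg_neg])) (mv_neg_le_iff.2 (by rwa [mv_neg_neg]))
  rw [mv_neg_neg, mv_sub_def, mv_sub_def, mv_neg_inj, mv_neg_neg] at h
  exact h

/-- The mixed case: the first sum overflows, the second does not. With `d = a - neg b`, the earlier
associativity applied to `neg a`, `d`, `c` shows `d + c ≤ a`; since `b + c = (d + c) + neg a`, the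
summand `neg a` can be cancelled. -/
theorem sub_neg_add_assoc' {a b c : A} (hab : a + b = neg 0) (hbc : b ≤ neg c) :
    a - neg b + c = a - neg (b + c) := by
  have hb : neg a ≤ b := mv_neg_le_iff.2 hab
  have he : b - neg a = a - neg b := mv_sub_neg_comm b a
  have h1 : a - neg b ≤ a := mv_sub_le_self _ _
  have h2 : a - neg b ≤ neg c := (he ▸ mv_sub_le_self b (neg a)).trans hbc
  have h3 := add_sub_neg_assoc (a := neg a) (b := a - neg b) (c := c)
    (mv_le_neg_comm.1 (by rwa [mv_neg_neg])) h2
  rw [add_comm (neg a), ← he, mv_sub_add_cancel hb, mv_le_iff_sub.1 hbc, he, eq_comm,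
    ← mv_le_iff_sub, mv_le_neg_comm, mv_neg_neg] at h3
  have h4 : b + c = (a - neg b + c) + neg a := by
    rw [← he, add_right_comm, mv_sub_add_cancel hb]
  rw [mv_sub_neg_comm a (b + c), h4, mv_add_sub_cancel (by rwa [mv_neg_neg])]

/-! ### Simple MV-algebras are archimedean chains -/

theorem le_add_nsmul_iff_neg_le {x y a : A} {n : ℕ} : x ≤ y + n • a ↔ neg y ≤ neg x + n • a := by
  rw [mv_le_def, mv_le_def, mv_neg_neg, ← add_assoc, ← add_assoc, add_comm y]

theorem mv_add_le_add {x y z t : A} (h : x ≤ y) (h' : z ≤ t) : x + z ≤ y + t :=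
  (mv_add_le_add_left h z).trans (by rw [add_comm, add_comm y]; exact mv_add_le_add_left h' y)

/-- The congruence generated by identifying `a` with `0`. -/
def principalCongruence (a : A) : MVCongruence A where
  r x y := ∃ n : ℕ, x ≤ y + n • a ∧ y ≤ x + n • a
  iseqv := by
    refine ⟨fun x => ⟨0, ?_, ?_⟩, fun ⟨n, h⟩ => ⟨n, h.2, h.1⟩, ?_⟩
    · exact mv_le_add_right _ _
    · exact mv_le_add_right _ _
    · rintro x y z ⟨n, h1, h2⟩ ⟨m, h3, h4⟩
      refine ⟨n + m, ?_, ?_⟩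
      · rw [add_comm n, add_nsmul, ← add_assoc]
        exact h1.trans (mv_add_le_add_left h3 _)
      · rw [add_nsmul, ← add_assoc]
        exact h4.trans (mv_add_le_add_left h2 _)
  oplus_congr := by
    rintro x x' y y' ⟨n, h1, h2⟩ ⟨m, h3, h4⟩
    refine ⟨n + m, ?_, ?_⟩
    · rw [add_nsmul, oplus_eq_add, oplus_eq_add, add_add_add_comm]
      exact mv_add_le_add h1 h3
    · rw [add_nsmul, oplus_eq_add, oplus_eq_add, add_add_add_comm]
      exact mv_add_le_add h2 h4
  neg_congr := by
    rintro x y ⟨n, h1, h2⟩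
    exact ⟨n, le_add_nsmul_iff_neg_le.1 h2, le_add_nsmul_iff_neg_le.1 h1⟩

/-- If no multiple of `a` reached the top, the principal congruence of `a` would not relate the top
to `0`; being proper it would be the identity, yet it relates `a` to `0`. -/
theorem IsSimpleMV.exists_nsmul_eq (hA : IsSimpleMV A) {a : A} (ha : a ≠ 0) :
    ∃ n : ℕ, n • a = neg 0 := by
  by_contra! hn
  refine ha (hA.2 (y := principalCongruence a) ⟨neg 0, 0, ?_⟩ ?_ a 0 ⟨1, ?_, ?_⟩)
  · rintro ⟨n, h, -⟩
    rw [zero_add] at h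
    exact hn n (le_antisymm (mv_le_neg_zero _) h)
  · rintro x y (rfl : x = y)
    exact (principalCongruence a).refl x
  · rw [one_nsmul, zero_add]
  · exact mv_zero_le _

theorem IsSimpleMV.zero_ne (hA : IsSimpleMV A) : (0 : A) ≠ neg 0 := by
  intro h
  obtain ⟨x, y, hxy⟩ := hA.1
  have key : ∀ x : A, x = 0 := fun x =>
    le_antisymm (by rw [h]; exact mv_le_neg_zero x) (mv_zero_le x)
  exact hxy ((key x).trans (key y).symm)

/-- Disjointness from `a` is additive, by residuation. Meets are expressed through lower bounds. -/
theorem inf_add_eq_zero {a b c : A} (hab : ∀ w, w ≤ a → w ≤ b → w = 0)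
    (hac : ∀ w, w ≤ a → w ≤ c → w = 0) (w : A) (ha : w ≤ a) (hbc : w ≤ b + c) : w = 0 := by
  refine hac w ha ?_
  have h : w - c ≤ b := mv_sub_le_iff.2 hbc
  have := hab _ ((mv_sub_le_self w c).trans ha) h
  exact mv_le_iff_sub.2 this

/-- Prelinearity. The element `x - (x - y)` is the meet of `x` and `y`; adding `w` to it stays below
`y`, so subtracting `w` from `x - y` removes nothing. -/
theorem sub_inf_sub_eq_zero (x y w : A) (h1 : w ≤ x - y) (h2 : w ≤ y - x) : w = 0 := by
  have hxy : x - (x - y) = y - (y - x) := by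
    rw [← mv_neg_inj, neg_mv_sub, neg_mv_sub, ← mv_neg_sub_neg y x, ← mv_neg_sub_neg x y,
      add_comm, mv_sub_add_comm, add_comm]
  have h3 : x - (x - y) + w ≤ y := by
    rw [hxy, add_comm]
    conv_rhs => rw [← mv_sub_add_cancel (mv_sub_le_self y x), add_comm]
    exact mv_add_le_add_left h2 _
  have h4 : x - y ≤ x - y - w := by
    have := mv_sub_le_sub_left h3 x
    rwa [mv_sub_add_eq, mv_sub_sub_cancel (mv_sub_le_self x y)] at this
  have h5 : x - y - w = x - y := le_antisymm (mv_sub_le_self _ _) h4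
  -- Now `w` is both absorbed by `x - y` under addition and disjoint enough from it to be cancelled,
  -- so `w = (x - y) - (x - y)`.
  have h6 := mv_add_sub_cancel (mv_le_neg_comm.1 (h5 ▸ mv_sub_le_neg (x - y) w))
  have h7 := mv_sub_add_cancel h1
  rw [h5, add_comm] at h7
  rw [h7] at h6
  rw [← h6, ← mv_le_iff_sub]

/-- If `y - x` is nonzero, a multiple of it is the top; but `x - y` is disjoint from every multiple
of `y - x`, hence is zero. -/
theorem IsSimpleMV.le_total (hA : IsSimpleMV A) (x y : A) : x ≤ y ∨ y ≤ x := by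
  by_contra! h
  obtain ⟨n, hn⟩ := hA.exists_nsmul_eq (a := y - x) (fun h' => h.2 (mv_le_iff_sub.2 h'))
  have key : ∀ n : ℕ, ∀ w, w ≤ x - y → w ≤ n • (y - x) → w = 0 := by
    intro n
    induction n with
    | zero =>
      intro w _ h
      rw [zero_nsmul] at h
      exact le_antisymm h (mv_zero_le w)
    | succ n ih =>
      rw [succ_nsmul]
      exact inf_add_eq_zero ih (sub_inf_sub_eq_zero x y)
  exact h.1 (mv_le_iff_sub.2 (key n _ le_rfl (hn ▸ mv_le_neg_zero _)))

/-! ### The Chang group of an MV-chain -/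

variable (A) in
/-- A nontrivial totally ordered MV-algebra. -/
class IsMVChain : Prop where
  zero_ne : (0 : A) ≠ neg 0
  le_total : ∀ x y : A, x ≤ y ∨ y ≤ x

theorem le_neg_of_add_ne [IsMVChain A] {x y : A} (h : x + y ≠ neg 0) : x ≤ neg y := by
  rcases IsMVChain.le_total (neg x) y with h' | h'
  · exact absurd (mv_neg_le_iff.1 h') h
  · exact mv_le_neg_comm.1 h'

variable (A) in
/-- Chang's group of an MV-chain: its elements consist of an integer part and a fractional part,
the latter being an element of the chain different from its top. -/
@[ext]
structure ChangGroup where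
  int : ℤ
  frac : A
  frac_ne : frac ≠ neg 0

namespace ChangGroup

theorem sub_neg_ne {x y : A} (hx : x ≠ neg 0) : x - neg y ≠ neg 0 := fun h =>
  hx (le_antisymm (mv_le_neg_zero x) (h ▸ mv_sub_le_self x (neg y)))

open Classical in
/-- Addition with carry. -/
noncomputable instance : Add (ChangGroup A) where
  add x y :=
    if h : x.frac + y.frac = neg 0 then
      ⟨x.int + y.int + 1, x.frac - neg y.frac, sub_neg_ne x.frac_ne⟩
    else ⟨x.int + y.int, x.frac + y.frac, h⟩

theorem add_of_eq {x y : ChangGroup A} (h : x.frac + y.frac = neg 0) :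
    x + y = ⟨x.int + y.int + 1, x.frac - neg y.frac, sub_neg_ne x.frac_ne⟩ := dif_pos h

theorem add_of_ne {x y : ChangGroup A} (h : x.frac + y.frac ≠ neg 0) :
    x + y = ⟨x.int + y.int, x.frac + y.frac, h⟩ := dif_neg h

theorem add_int_le (x y : ChangGroup A) : x.int + y.int ≤ (x + y).int := by
  by_cases h : x.frac + y.frac = neg 0
  · rw [add_of_eq h]; simp
  · rw [add_of_ne h]

theorem add_comm' (x y : ChangGroup A) : x + y = y + x := by
  by_cases h : x.frac + y.frac = neg 0
  · rw [add_of_eq h, add_of_eq (by rwa [add_comm])]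
    ext
    · simp [add_comm]
    · exact mv_sub_neg_comm _ _
  · rw [add_of_ne h, add_of_ne (by rwa [add_comm])]
    ext
    · simp [add_comm]
    · exact add_comm _ _

theorem add_assoc_of_eq_of_ne [IsMVChain A] {x y z : ChangGroup A}
    (h : x.frac + y.frac = neg 0) (h' : y.frac + z.frac ≠ neg 0) :
    x + y + z = x + (y + z) := by
  have e := sub_neg_add_assoc' h (le_neg_of_add_ne h')
  rw [add_of_eq h, add_of_ne h', add_of_ne, add_of_eq]
  · ext
    · simp only; ring
    · exact e
  · simp only
    rw [← add_assoc, h, neg_zero_add]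
  · simp only
    rw [e]
    exact sub_neg_ne x.frac_ne

/-- Four cases, by which of the two inner sums carry; each is one of the associativity laws for
partial sums, and the second mixed case follows from the first by commutativity. -/
theorem add_assoc' [IsMVChain A] (x y z : ChangGroup A) : x + y + z = x + (y + z) := by
  by_cases h : x.frac + y.frac = neg 0 <;> by_cases h' : y.frac + z.frac = neg 0
  · have e := sub_neg_add_assoc h h'
    rw [add_of_eq h, add_of_eq h']
    by_cases h1 : x.frac - neg y.frac + z.frac = neg 0
    · rw [add_of_eq h1, add_of_eq (by rwa [← e])]
      ext
      · simp only; ring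
      · simp only
        rw [← mv_sub_add_eq, neg_mv_sub]
    · rw [add_of_ne h1, add_of_ne (by rwa [← e])]
      ext
      · simp only; ring
      · exact e
  · exact add_assoc_of_eq_of_ne h h'
  · rw [add_comm' x (y + z), add_comm' y z, add_comm' x y, add_comm' _ z]
    exact (add_assoc_of_eq_of_ne (by rwa [add_comm]) (by rwa [add_comm])).symm
  · have e := add_sub_neg_assoc (le_neg_of_add_ne h) (le_neg_of_add_ne h')
    rw [add_of_ne h, add_of_ne h']
    by_cases h1 : x.frac + y.frac + z.frac = neg 0
    · rw [add_of_eq h1, add_of_eq (by rwa [← add_assoc])]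
      ext
      · simp only; ring
      · exact e
    · rw [add_of_ne h1, add_of_ne (by rwa [← add_assoc])]
      ext
      · simp only; ring
      · exact add_assoc _ _ _

variable [IsMVChain A]

/-- The element of the Chang group with given integer part and zero fractional part. -/
def ofInt (n : ℤ) : ChangGroup A := ⟨n, 0, IsMVChain.zero_ne⟩

instance : Zero (ChangGroup A) := ⟨ofInt 0⟩

instance : One (ChangGroup A) := ⟨ofInt 1⟩

theorem add_ofInt (x : ChangGroup A) (n : ℤ) : x + ofInt n = ⟨x.int + n, x.frac, x.frac_ne⟩ := by
  rw [add_of_ne]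
  · ext
    · rfl
    · exact add_zero _
  · exact (add_zero x.frac).symm ▸ x.frac_ne

open Classical in
noncomputable instance : Neg (ChangGroup A) where
  neg x :=
    if h : x.frac = 0 then ofInt (-x.int)
    else ⟨-x.int - 1, neg x.frac, fun h' => h (mv_neg_inj.1 h')⟩

theorem neg_of_eq {x : ChangGroup A} (h : x.frac = 0) : -x = ofInt (-x.int) := dif_pos h

theorem neg_of_ne {x : ChangGroup A} (h : x.frac ≠ 0) :
    -x = ⟨-x.int - 1, neg x.frac, fun h' => h (mv_neg_inj.1 h')⟩ := dif_neg h

noncomputable instance : AddCommGroup (ChangGroup A) where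
  add_assoc := add_assoc'
  add_comm := add_comm'
  add_zero x := by
    rw [show (0 : ChangGroup A) = ofInt 0 from rfl, add_ofInt]
    simp
  zero_add x := by
    rw [add_comm', show (0 : ChangGroup A) = ofInt 0 from rfl, add_ofInt]
    simp
  nsmul := nsmulRec
  zsmul := zsmulRec
  neg_add_cancel x := by
    rw [add_comm']
    by_cases h : x.frac = 0
    · rw [neg_of_eq h, add_ofInt]
      ext
      · exact add_neg_cancel _
      · exact h
    · rw [neg_of_ne h, add_of_eq (by simp only; rw [add_comm]; exact neg_oplus_self _)]
      ext
      · simp only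
        rw [show (0 : ChangGroup A) = ofInt 0 from rfl, ofInt]
        ring
      · simp only
        rw [mv_neg_neg, mv_le_iff_sub.1 le_rfl]
        rfl

/-- Elements with nonnegative integer part. -/
def nonneg : AddGroupCone (ChangGroup A) where
  carrier := {x | 0 ≤ x.int}
  add_mem' {x y} hx hy := (add_nonneg hx hy).trans (add_int_le x y)
  zero_mem' := le_refl (0 : ℤ)
  eq_zero_of_mem_of_neg_mem' {x} hx hx' := by
    simp only [Set.mem_ofPred_eq] at hx hx'
    by_cases h : x.frac = 0
    · rw [neg_of_eq h] at hx'
      simp only [ofInt] at hx'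
      ext
      · exact le_antisymm (neg_nonneg.1 hx') hx
      · exact h
    · rw [neg_of_ne h] at hx'
      simp only at hx'
      omega

instance : HasMemOrNegMem (nonneg (A := A)) where
  mem_or_neg_mem x := by
    by_contra! h
    have h1 : ¬ 0 ≤ x.int := h.1
    have h2 : ¬ 0 ≤ (-x).int := h.2
    by_cases h' : x.frac = 0
    · rw [neg_of_eq h'] at h2
      simp only [ofInt] at h2
      omega
    · rw [neg_of_ne h'] at h2
      simp only at h2
      omega

open Classical in
noncomputable instance : LinearOrder (ChangGroup A) := LinearOrder.mkOfAddGroupCone nonneg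

instance : IsOrderedAddMonoid (ChangGroup A) := IsOrderedAddMonoid.mkOfCone nonneg

theorem le_def {x y : ChangGroup A} : x ≤ y ↔ 0 ≤ (y - x).int := Iff.rfl

theorem nonneg_iff {x : ChangGroup A} : 0 ≤ x ↔ 0 ≤ x.int := by rw [le_def, sub_zero]

theorem one_eq : (1 : ChangGroup A) = ofInt 1 := rfl

theorem ofInt_le_iff {n : ℤ} {x : ChangGroup A} : ofInt n ≤ x ↔ n ≤ x.int := by
  have : -(ofInt n : ChangGroup A) = ofInt (-n) := neg_of_eq rfl
  rw [le_def, sub_eq_add_neg, this, add_ofInt]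
  simp only
  omega

theorem le_ofInt {x : ChangGroup A} {n : ℤ} (h : x.int < n) : x ≤ ofInt n := by
  rw [← not_lt]
  intro h'
  have := ofInt_le_iff.1 h'.le
  omega

instance : ZeroLEOneClass (ChangGroup A) := ⟨nonneg_iff.2 zero_le_one⟩

instance : NeZero (1 : ChangGroup A) := ⟨fun h => one_ne_zero (congrArg ChangGroup.int h)⟩

theorem ofInt_nat (n : ℕ) : n • (1 : ChangGroup A) = ofInt n := by
  induction n with
  | zero => rw [zero_nsmul]; rfl
  | succ n ih => rw [succ_nsmul, ih, one_eq, add_ofInt]; ext <;> simp [ofInt]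

theorem exists_one_le_nsmul (hA : ∀ a : A, a ≠ 0 → ∃ n : ℕ, n • a = neg 0) {y : ChangGroup A}
    (hy : 0 < y) : ∃ n : ℕ, 1 ≤ n • y := by
  rcases (nonneg_iff.1 hy.le).lt_or_eq with h | h
  · exact ⟨1, by rw [one_nsmul, one_eq, ofInt_le_iff]; omega⟩
  · have hf : y.frac ≠ 0 := fun h' => hy.ne (ChangGroup.ext h h'.symm)
    obtain ⟨n, hn⟩ := hA _ hf
    refine ⟨n, ?_⟩
    by_contra! hlt
    -- As long as the multiples stay below `1` no carry occurs, so fractional parts add as in `A`;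
    -- at `m = n` the fractional part would be the top, which is excluded.
    have key : ∀ m ≤ n, (m • y).int = 0 ∧ (m • y).frac = m • y.frac := by
      intro m
      induction m with
      | zero =>
        intro _
        rw [zero_nsmul, zero_nsmul]
        exact ⟨rfl, rfl⟩
      | succ m ih =>
        intro hm
        obtain ⟨h1, h2⟩ := ih (by omega)
        have h3 : ((m + 1) • y).int < 1 := by
          rw [← not_le, ← ofInt_le_iff, ← one_eq, not_le]
          exact (nsmul_le_nsmul_left hy.le hm).trans_lt hlt
        rw [succ_nsmul] at h3 ⊢
        have h4 : (m • y).frac + y.frac ≠ neg 0 := by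
          intro h4
          rw [add_of_eq h4] at h3
          simp only at h3
          omega
        rw [add_of_ne h4]
        simp only [h1, ← h, h2, add_zero, true_and]
        rw [succ_nsmul]
    exact (n • y).frac_ne ((key n le_rfl).2.trans hn)

theorem archimedean (hA : ∀ a : A, a ≠ 0 → ∃ n : ℕ, n • a = neg 0) :
    Archimedean (ChangGroup A) where
  arch x y hy := by
    obtain ⟨n, hn⟩ := exists_one_le_nsmul hA hy
    -- An element lies below the integer following its integer part, and `n • y` is at least `1`.
    refine ⟨(x.int + 1).toNat * n, ?_⟩
    rw [mul_nsmul']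
    refine le_trans ?_ (nsmul_le_nsmul_right hn _)
    rw [ofInt_nat]
    refine le_ofInt ?_
    omega

/-- The inclusion of a chain into its Chang group, sending the top to `1`. -/
theorem exists_map (A : Type u) [MVAlgebra A] [IsMVChain A] : ∃ ι : A → ChangGroup A,
    ι (neg 0) = 1 ∧ ι 0 = 0 ∧ (∀ a, 0 ≤ ι a ∧ ι a ≤ 1) ∧ (∀ a, ι (neg a) = 1 - ι a) ∧
      ∀ a b, ι (a + b) = min (ι a + ι b) 1 := by
  classical
  let ι : A → ChangGroup A := fun a => if h : a = neg 0 then 1 else ⟨0, a, h⟩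
  have h1 : ι (neg 0) = 1 := dif_pos rfl
  have hne : ∀ a, (h : a ≠ neg 0) → ι a = ⟨0, a, h⟩ := fun a h => dif_neg h
  have h0 : ι 0 = 0 := hne 0 IsMVChain.zero_ne
  have hb : ∀ a, 0 ≤ ι a ∧ ι a ≤ 1 := by
    intro a
    by_cases h : a = neg 0
    · rw [h, h1]
      exact ⟨zero_le_one, le_rfl⟩
    · rw [hne a h]
      exact ⟨nonneg_iff.2 le_rfl, le_ofInt zero_lt_one⟩
  refine ⟨ι, h1, h0, hb, ?_, ?_⟩
  · intro a
    rw [eq_sub_iff_add_eq]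
    by_cases h : a = neg 0
    · rw [h, h1, mv_neg_neg, h0, zero_add]
    by_cases h' : a = 0
    · rw [h', h0, h1, add_zero]
    have h'' : neg a ≠ neg 0 := fun e => h' (mv_neg_inj.1 e)
    rw [hne _ h, hne _ h'', add_of_eq (neg_oplus_self a)]
    ext
    · rfl
    · simp only
      exact mv_le_iff_sub.1 le_rfl
  · intro a b
    by_cases ha : a = neg 0
    · rw [ha, neg_zero_add, h1, min_eq_right]
      exact le_add_of_nonneg_right (hb b).1
    by_cases hb' : b = neg 0
    · rw [hb', add_neg_zero, h1, min_eq_right]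
      exact le_add_of_nonneg_left (hb a).1
    rw [hne a ha, hne b hb']
    by_cases h : a + b = neg 0
    · rw [h, h1, add_of_eq h, min_eq_right]
      rw [one_eq, ofInt_le_iff]
      simp
    · rw [hne _ h, add_of_ne h, min_eq_left]
      · rfl
      · exact le_ofInt zero_lt_one

end ChangGroup

/-! ### Embedding simple algebras in the unit interval -/

theorem IsSimpleMV.exists_hom (hA : IsSimpleMV A) : ∃ f : A → unitInterval, IsMVHom f := by
  have : IsMVChain A := ⟨hA.zero_ne, hA.le_total⟩
  have := ChangGroup.archimedean fun a (ha : a ≠ 0) => hA.exists_nsmul_eq ha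
  obtain ⟨ι, -, h0, hb, hn, ha⟩ := ChangGroup.exists_map A
  let e := Archimedean.embedReal (ChangGroup A)
  have e1 : e 1 = 1 := Archimedean.embedReal_one
  refine ⟨fun a => ⟨e (ι a), ?_, ?_⟩, ?_, ?_, ?_⟩
  · rw [← map_zero e]
    exact OrderHomClass.mono e (hb a).1
  · rw [← e1]
    exact OrderHomClass.mono e (hb a).2
  · apply Subtype.ext
    exact (congrArg e h0).trans (map_zero e)
  · intro x y
    apply Subtype.ext
    change e (ι (x + y)) = min (e (ι x) + e (ι y)) 1
    rw [ha, (OrderHomClass.mono e).map_min, map_add, e1]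
  · intro x
    apply Subtype.ext
    change e (ι (neg x)) = 1 - e (ι x)
    rw [hn, map_sub, e1]

/-- The kernel of `f` is proper because `0 ≠ 1` in `[0,1]`, so it is the identity. -/
theorem IsSimpleMV.injective (hA : IsSimpleMV A) {f : A → unitInterval} (hf : IsMVHom f) :
    Function.Injective f := by
  intro x y hxy
  let θ : MVCongruence A :=
    { r := fun x y => f x = f y
      iseqv := ⟨fun _ => rfl, Eq.symm, Eq.trans⟩
      oplus_congr := fun h h' => by rw [hf.map_oplus, hf.map_oplus, h, h']
      neg_congr := fun h => by rw [hf.map_neg, hf.map_neg, h] }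
  refine hA.2 (y := θ) ⟨zero, neg zero, ?_⟩ ?_ x y hxy
  · intro h
    have h : f zero = f (neg zero) := h
    rw [hf.map_neg, hf.map_zero] at h
    exact zero_ne_one (h.trans unitInterval.symm_zero)
  · rintro x y (rfl : x = y)
    rfl

end Order

theorem IsSemisimpleMV.exists_hom_ne {A : Type u} [MVAlgebra A] (hA : IsSemisimpleMV A) {a b : A}
    (hab : a ≠ b) : ∃ f : A → unitInterval, IsMVHom f ∧ f a ≠ f b := by
  obtain ⟨ι, S, _, h, hS, hh, -, hinj⟩ := hA
  obtain ⟨i, hi⟩ := Function.ne_iff.1 (hinj.ne hab)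
  obtain ⟨f, hf⟩ := (hS i).exists_hom
  exact ⟨f ∘ h i, hf.comp (hh i), fun e => hi ((hS i).injective hf e)⟩

/-! ### McNaughton's theorem -/

/-- A continuous function on `[0,1]` with finitely many affine pieces has, for its endpoints, an
affine piece lying above it at `0` and below it at `1`. -/
theorem exists_affine_piece {ι : Type v} (L : Finset ι) (a b : ι → ℝ) {h : ℝ → ℝ}
    (hc : Continuous h) (hL : ∀ t ∈ Set.Icc (0 : ℝ) 1, ∃ q ∈ L, h t = a q + t * b q) :
    ∃ q ∈ L, h 0 ≤ a q ∧ a q + b q ≤ h 1 := by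
  let s : Set ℝ := ⋃ q ∈ L, {t | h 0 ≤ a q ∧ a q + t * b q ≤ h t}
  have hs : IsClosed s := by
    refine L.finite_toSet.isClosed_biUnion fun q _ => ?_
    exact isClosed_const.inter (isClosed_le (f := fun t => a q + t * b q) (by fun_prop) hc)
  have mem_s : ∀ t, t ∈ s ↔ ∃ q ∈ L, h 0 ≤ a q ∧ a q + t * b q ≤ h t := by
    intro t
    simp only [s, Set.mem_iUnion, exists_prop, Set.mem_ofPred_eq]
  have key : Set.Icc (0 : ℝ) 1 ⊆ s := by
    -- Continuous induction: `s` holds the times `t` at which some piece is above `h` at `0` and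
    -- below `h` at `t`. It is closed and contains `0`; it must be shown to extend to the right of
    -- each of its points.
    refine (hs.inter isClosed_Icc).Icc_subset_of_forall_mem_nhdsWithin ?_ ?_
    · obtain ⟨q, hq, e⟩ := hL 0 ⟨le_rfl, zero_le_one⟩
      exact (mem_s 0).2 ⟨q, hq, by linarith, by linarith⟩
    · rintro t ⟨ht, ht0, ht1⟩
      obtain ⟨p, hp, hp0, hpt⟩ := (mem_s t).1 ht
      -- By continuity and finiteness, a piece active at a point near `t` is already active at `t`.
      have hev : ∀ᶠ r in nhds t, ∀ q ∈ L, h r = a q + r * b q → h t = a q + t * b q := by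
        rw [Filter.eventually_all_finset]
        intro q _
        by_cases e : h t = a q + t * b q
        · exact Filter.Eventually.of_forall fun _ _ => e
        · have : ContinuousAt (fun r => h r - (a q + r * b q)) t := by fun_prop
          filter_upwards [this.eventually_ne (sub_ne_zero.2 e)] with r hr hr'
          exact absurd (sub_eq_zero.2 hr') hr
      filter_upwards [hev.filter_mono nhdsWithin_le_nhds, Ioo_mem_nhdsGT ht1] with r hr hr1
      rw [mem_s]
      obtain ⟨q, hq, e⟩ := hL r ⟨ht0.trans hr1.1.le, hr1.2.le⟩
      have e' := hr q hq e
      by_cases hpr : a p + r * b p ≤ h r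
      · exact ⟨p, hp, hp0, hpr⟩
      · refine ⟨q, hq, ?_, e.ge⟩
        have hlt := hr1.1
        push Not at hpr
        -- The piece `q` meets `h` at `t` and at `r`, so `p` is at most `q` at `t` and exceeds it at
        -- `r`. Hence `p` is steeper, and going back to `0` keeps `q` above `p`.
        have hslope : 0 ≤ b p - b q := by
          by_contra! hneg
          nlinarith
        nlinarith
  simpa using (mem_s 1).1 (key ⟨zero_le_one, le_rfl⟩)

/-- The value at `x` of the affine function with the given integer coefficients. -/
def affineVal {n : Type v} [Fintype n] (q : ℤ × (n → ℤ)) (x : n → unitInterval) : ℝ :=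
  (q.1 : ℝ) + ∑ i, (q.2 i : ℝ) * (x i : ℝ)

/-- The one-variable statement along the segment from `y` to `x`, where each affine function is
affine in the parameter. The projection in `γ` only makes it total; it has no effect for parameters
in `[0,1]`. -/
theorem exists_affineVal_separating {n : Type v} [Fintype n] {f : (n → unitInterval) → unitInterval}
    (hf : Continuous f) (F : Finset (ℤ × (n → ℤ))) (hF : ∀ x, ∃ q ∈ F, (f x : ℝ) = affineVal q x)
    (x y : n → unitInterval) :
    ∃ q ∈ F, (f y : ℝ) ≤ affineVal q y ∧ affineVal q x ≤ f x := by
  let γ : ℝ → n → unitInterval := fun t i =>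
    Set.projIcc 0 1 zero_le_one ((1 - t) * (y i : ℝ) + t * (x i : ℝ))
  have hγ : Continuous γ := continuous_pi fun i => continuous_projIcc.comp (by fun_prop)
  have hγv : ∀ t ∈ Set.Icc (0 : ℝ) 1, ∀ i,
      (γ t i : ℝ) = (1 - t) * (y i : ℝ) + t * (x i : ℝ) := by
    intro t ht i
    have : (1 - t) * (y i : ℝ) + t * (x i : ℝ) ∈ Set.Icc (0 : ℝ) 1 :=
      convex_Icc 0 1 (y i).2 (x i).2 (by linarith [ht.2]) ht.1 (by ring)
    simp only [γ, Set.projIcc_of_mem zero_le_one this]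
  have hγ0 : γ 0 = y := funext fun i => Subtype.ext (by rw [hγv 0 ⟨le_rfl, zero_le_one⟩]; ring)
  have hγ1 : γ 1 = x := funext fun i => Subtype.ext (by rw [hγv 1 ⟨zero_le_one, le_rfl⟩]; ring)
  obtain ⟨q, hq, h0, h1⟩ := exists_affine_piece F (fun q => affineVal q y)
    (fun q => affineVal q x - affineVal q y) (h := fun t => (f (γ t) : ℝ)) (by fun_prop) (by
      intro t ht
      obtain ⟨q, hq, e⟩ := hF (γ t)
      refine ⟨q, hq, e.trans ?_⟩
      simp only [affineVal, hγv t ht]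
      have : ∑ i, (q.2 i : ℝ) * ((1 - t) * (y i : ℝ) + t * (x i : ℝ)) =
          (1 - t) * ∑ i, (q.2 i : ℝ) * (y i : ℝ) + t * ∑ i, (q.2 i : ℝ) * (x i : ℝ) := by
        rw [Finset.mul_sum, Finset.mul_sum, ← Finset.sum_add_distrib]
        exact Finset.sum_congr rfl fun i _ => by ring
      rw [this]
      ring)
  simp only [hγ0, hγ1] at h0 h1
  exact ⟨q, hq, h0, by linarith⟩

/-- Truncation of a real number to the unit interval. -/
noncomputable abbrev clamp (x : ℝ) : unitInterval := Set.projIcc 0 1 zero_le_one x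

theorem coe_clamp (x : ℝ) : (clamp x : ℝ) = max 0 (min 1 x) := rfl

theorem clamp_coe (x : unitInterval) : clamp x = x := Set.projIcc_val _ x

/-- Lattice representation of a continuous piecewise affine function. -/
theorem IsIntPLFin.exists_sup_inf {n : Type v} [Fintype n] {f : (n → unitInterval) → unitInterval}
    (hf : IsIntPLFin f) : ∃ T : Finset (Finset (ℤ × (n → ℤ))),
      ∀ x, f x = T.sup fun S => S.inf fun q => clamp (affineVal q x) := by
  classical
  obtain ⟨hc, F, hFfin, hF⟩ := hf
  lift F to Finset (ℤ × (n → ℤ)) using hFfin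
  -- The minimum of the pieces in `S y` is at least `f` at `y`, and by `exists_affineVal_separating`
  -- at most `f` everywhere. Only finitely many sets `S y` occur.
  let S : (n → unitInterval) → Finset (ℤ × (n → ℤ)) := fun y =>
    F.filter fun q => (f y : ℝ) ≤ affineVal q y
  refine ⟨F.powerset.filter fun s => ∃ y, S y = s, fun x => le_antisymm ?_ ?_⟩
  · refine le_trans ?_ (Finset.le_sup (b := S x)
      (Finset.mem_filter.2 ⟨Finset.mem_powerset.2 (Finset.filter_subset _ _), x, rfl⟩))
    refine Finset.le_inf fun q hq => ?_
    rw [← clamp_coe (f x)]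
    exact Set.monotone_projIcc _ (Finset.mem_filter.1 hq).2
  · refine Finset.sup_le fun s hs => ?_
    obtain ⟨-, y, rfl⟩ := Finset.mem_filter.1 hs
    obtain ⟨q, hq, h0, h1⟩ := exists_affineVal_separating hc F hF x y
    refine (Finset.inf_le (Finset.mem_filter.2 ⟨hq, h0⟩)).trans ?_
    rw [← clamp_coe (f x)]
    exact Set.monotone_projIcc _ h1

/-! ### Truncated affine functions as MV-terms -/

/-- Sets of `[0,1]`-valued functions closed under the pointwise MV-operations. -/
structure IsMVClosed {D : Type v} (P : (D → unitInterval) → Prop) : Prop where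
  zero : P fun _ => 0
  oplus : ∀ {f g}, P f → P g → P fun d => truncAdd (f d) (g d)
  neg : ∀ {f}, P f → P fun d => unitInterval.symm (f d)

theorem coe_truncAdd (x y : unitInterval) : (truncAdd x y : ℝ) = min ((x : ℝ) + y) 1 := rfl

theorem sup_eq_truncAdd (x y : unitInterval) :
    x ⊔ y = truncAdd (unitInterval.symm (truncAdd (unitInterval.symm x) y)) y := by
  apply Subtype.ext
  have hy := y.2.1
  have hx := x.2.2
  rcases le_total x y with h | h
  · rw [sup_eq_right.2 h]
    have h : (x : ℝ) ≤ y := h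
    simp only [coe_truncAdd, unitInterval.coe_symm_eq]
    rw [min_eq_right (a := 1 - (x : ℝ) + y) (by linarith), sub_self, zero_add, min_eq_left y.2.2]
  · rw [sup_eq_left.2 h]
    have h : (y : ℝ) ≤ x := h
    simp only [coe_truncAdd, unitInterval.coe_symm_eq]
    rw [min_eq_left (a := 1 - (x : ℝ) + y) (by linarith), min_eq_left (by linarith)]
    ring

theorem clamp_neg (r : ℝ) : clamp (1 - r) = unitInterval.symm (clamp r) := by
  apply Subtype.ext
  simp only [unitInterval.coe_symm_eq, coe_clamp]
  rcases le_total r 0 with h | h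
  · rw [min_eq_left (by linarith), min_eq_right (by linarith), max_eq_left h]; simp
  rcases le_total r 1 with h' | h'
  · rw [min_eq_right (by linarith), min_eq_right h', max_eq_right h, max_eq_right (by linarith)]
  · rw [min_eq_right (by linarith), min_eq_left h', max_eq_left (by linarith)]; simp

/-- With `u ⊙ v = ¬(¬u ⊕ ¬v)`, this expresses the truncation of `r + x` as `(clamp r ⊕ x) ⊙ clamp (r
+ 1)`. For `r ≥ 0` the second factor is `1`; for `-1 ≤ r ≤ 0` the first is `x`, giving `max 0 (x +
r)`; for `r ≤ -1` both sides vanish. -/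
theorem clamp_add (r : ℝ) (x : unitInterval) :
    clamp (r + x) = unitInterval.symm (truncAdd
      (unitInterval.symm (truncAdd (clamp r) x)) (unitInterval.symm (clamp (r + 1)))) := by
  apply Subtype.ext
  have hx := x.2.1
  have hx' := x.2.2
  simp only [unitInterval.coe_symm_eq, coe_clamp, coe_truncAdd]
  rcases le_total r (-1) with h1 | h1
  · rw [min_eq_right (a := (1 : ℝ)) (b := r + 1) (by linarith), max_eq_left (b := r + 1) (by linarith),
      min_eq_right (b := r + x) (by linarith), max_eq_left (b := r + x) (by linarith), min_eq_right]
    · ring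
    · linarith [min_le_right (max 0 (min 1 r) + (x : ℝ)) 1]
  rcases le_total r 0 with h | h
  · rw [min_eq_right (a := (1 : ℝ)) (b := r + 1) (by linarith),
      max_eq_right (b := r + 1) (by linarith),
      min_eq_right (b := r + x) (by linarith), min_eq_right (a := (1 : ℝ)) (b := r) (by linarith),
      max_eq_left h, zero_add, min_eq_left hx']
    rcases le_total (r + x) 0 with h2 | h2
    · rw [max_eq_left h2, min_eq_right (by linarith), sub_self]
    · rw [max_eq_right h2, min_eq_left (by linarith)]
      ring
  · rw [min_eq_left (a := (1 : ℝ)) (b := r + 1) (by linarith), max_eq_right (zero_le_one' ℝ),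
      sub_self, add_zero]
    rcases le_total r 1 with h2 | h2
    · rw [min_eq_right h2, max_eq_right h, min_comm 1, max_eq_right (le_min (by linarith) zero_le_one),
        min_eq_left (a := 1 - min (r + (x : ℝ)) 1), sub_sub_cancel]
      linarith [le_min (show 0 ≤ r + (x : ℝ) by linarith) zero_le_one]
    · rw [min_eq_left h2, min_eq_left (a := (1 : ℝ)) (b := r + x) (by linarith),
        max_eq_right (zero_le_one' ℝ), min_eq_right (a := 1 + (x : ℝ)) (by linarith)]
      simp

namespace IsMVClosed

variable {D : Type v} {P : (D → unitInterval) → Prop}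

theorem one (hP : IsMVClosed P) : P fun _ => 1 := by
  simpa using hP.neg hP.zero

theorem sup (hP : IsMVClosed P) {f g : D → unitInterval} (hf : P f) (hg : P g) :
    P fun d => f d ⊔ g d := by
  simp only [sup_eq_truncAdd]
  exact hP.oplus (hP.neg (hP.oplus (hP.neg hf) hg)) hg

theorem inf (hP : IsMVClosed P) {f g : D → unitInterval} (hf : P f) (hg : P g) :
    P fun d => f d ⊓ g d := by
  have h : ∀ x y : unitInterval,
      x ⊓ y = unitInterval.symm (unitInterval.symm x ⊔ unitInterval.symm y) := by
    intro x y
    rw [unitInterval.strictAnti_symm.antitone.map_sup, unitInterval.symm_symm,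
      unitInterval.symm_symm]
  simp only [h]
  exact hP.neg (hP.sup (hP.neg hf) (hP.neg hg))

theorem finset_sup (hP : IsMVClosed P) {ι : Type w} (s : Finset ι) {f : ι → D → unitInterval}
    (hf : ∀ i ∈ s, P (f i)) : P fun d => s.sup fun i => f i d := by
  classical
  induction s using Finset.induction_on with
  | empty => exact hP.zero
  | insert i s _ ih =>
    simp only [Finset.sup_insert]
    exact hP.sup (hf i (Finset.mem_insert_self i s))
      (ih fun j hj => hf j (Finset.mem_insert_of_mem hj))

theorem finset_inf (hP : IsMVClosed P) {ι : Type w} (s : Finset ι) {f : ι → D → unitInterval}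
    (hf : ∀ i ∈ s, P (f i)) : P fun d => s.inf fun i => f i d := by
  classical
  induction s using Finset.induction_on with
  | empty => exact hP.one
  | insert i s _ ih =>
    simp only [Finset.inf_insert]
    exact hP.inf (hf i (Finset.mem_insert_self i s))
      (ih fun j hj => hf j (Finset.mem_insert_of_mem hj))

theorem clamp_neg (hP : IsMVClosed P) {g : D → ℝ} (hg : ∀ c : ℤ, P fun d => clamp (g d + c))
    (c : ℤ) : P fun d => clamp (-g d + c) := by
  have h : ∀ d, clamp (-g d + c) = unitInterval.symm (clamp (g d + (1 - c : ℤ))) := by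
    intro d
    rw [← MVDuality.clamp_neg]
    congr 1
    push_cast
    ring
  simp only [h]
  exact hP.neg (hg _)

/-- All integer shifts of `g` are carried along because the shift `c` of the sum needs the shift `c
+ 1` of `g`. -/
theorem clamp_add (hP : IsMVClosed P) {g : D → ℝ} (hg : ∀ c : ℤ, P fun d => clamp (g d + c))
    {x : D → unitInterval} (hx : P x) (c : ℤ) : P fun d => clamp (g d + x d + c) := by
  have h : ∀ d, clamp (g d + x d + c) = clamp (g d + c + x d) := fun d => by rw [add_right_comm]
  have h' : ∀ d, clamp (g d + c + 1) = clamp (g d + (c + 1 : ℤ)) := fun d => by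
    rw [add_assoc]; push_cast; rfl
  simp only [h, MVDuality.clamp_add, h']
  exact hP.neg (hP.oplus (hP.neg (hP.oplus (hg c) hx)) (hP.neg (hg (c + 1))))

theorem clamp_add_int_mul (hP : IsMVClosed P) {g : D → ℝ}
    (hg : ∀ c : ℤ, P fun d => clamp (g d + c)) {x : D → unitInterval} (hx : P x) (m : ℤ) :
    ∀ c : ℤ, P fun d => clamp (g d + m * x d + c) := by
  induction m using Int.induction_on with
  | zero => simpa using hg
  | succ m ih =>
    intro c
    have := hP.clamp_add ih hx c
    push_cast at this ⊢
    simpa only [add_mul, one_mul, add_assoc] using this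
  | pred m ih =>
    intro c
    -- Subtraction is addition between two negations: `g - x = -(-g + x)`.
    have := hP.clamp_neg (hP.clamp_add (hP.clamp_neg ih) hx) c
    convert this using 3
    push_cast
    ring

theorem clamp_affine (hP : IsMVClosed P) {n : Type w} [Fintype n] {x : n → D → unitInterval}
    (hx : ∀ i, P (x i)) (q : ℤ × (n → ℤ)) : P fun d => clamp (affineVal q fun i => x i d) := by
  classical
  have key : ∀ s : Finset n, ∀ c : ℤ,
      P fun d => clamp (∑ i ∈ s, (q.2 i : ℝ) * (x i d : ℝ) + c) := by
    intro s
    induction s using Finset.induction_on with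
    | empty =>
      intro c
      simp only [Finset.sum_empty, zero_add]
      rcases le_or_gt c 0 with h | h
      · have : clamp (c : ℝ) = 0 := Set.projIcc_of_le_left _ (by exact_mod_cast h)
        rw [this]
        exact hP.zero
      · have : clamp (c : ℝ) = 1 := Set.projIcc_of_right_le _ (by exact_mod_cast h)
        rw [this]
        exact hP.one
    | insert i s hi ih =>
      simp only [Finset.sum_insert hi, add_comm ((q.2 i : ℝ) * _)]
      exact hP.clamp_add_int_mul ih (hx i) _
  simp only [affineVal, add_comm (q.1 : ℝ)]
  exact key _ _

theorem of_isIntPLFin (hP : IsMVClosed P) {n : Type w} [Fintype n] {x : n → D → unitInterval}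
    (hx : ∀ i, P (x i)) {f : (n → unitInterval) → unitInterval} (hf : IsIntPLFin f) :
    P fun d => f fun i => x i d := by
  obtain ⟨T, hT⟩ := hf.exists_sup_inf
  simp only [hT]
  exact hP.finset_sup T fun S _ => hP.finset_inf S fun q _ => hP.clamp_affine hx q

/-- McNaughton's theorem: a set of functions closed under the MV-operations is closed under
composition with continuous piecewise linear functions with integer coefficients. -/
theorem of_isIntPL (hP : IsMVClosed P) {I : Type w} {x : I → D → unitInterval}
    (hx : ∀ i, P (x i)) {f : (I → unitInterval) → unitInterval} (hf : IsIntPL f) :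
    P fun d => f fun i => x i d := by
  obtain ⟨s, g, hg, hfg⟩ := hf
  simp only [hfg]
  exact hP.of_isIntPLFin (fun i : s => hx i) hg

end IsMVClosed

/-! ### Simple and semisimple algebras of functions -/

/-- A congruence identifying two distinct elements identifies their positive difference with `0`.
Some multiple of that difference is the top since the reals are archimedean, so the congruence is
total. -/
theorem isSimpleMV_of_injective {A : Type u} [MVAlgebra A] {f : A → unitInterval} (hf : IsMVHom f)
    (hinj : Function.Injective f) : IsSimpleMV A := by
  have hone : f (neg zero) = 1 := by
    rw [hf.map_neg, hf.map_zero]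
    exact unitInterval.symm_zero
  have hzero : f zero = 0 := hf.map_zero
  refine ⟨⟨zero, neg zero, fun h => ?_⟩, fun θ ⟨s, t, hst⟩ _ => ?_⟩
  · have h := congrArg f (show (zero : A) = neg zero from h)
    rw [hone, hzero] at h
    exact zero_ne_one h
  have key : ∀ x y, f x < f y → ¬ θ.r x y := by
    intro x y hlt hxy
    obtain ⟨d, hd, hfd⟩ : ∃ d, θ.r d zero ∧ 0 < (f d : ℝ) := by
      refine ⟨neg (oplus (neg y) x), ?_, ?_⟩
      · have := θ.neg_congr (θ.oplus_congr (θ.neg_congr (θ.symm' hxy)) (θ.refl' x))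
        rwa [neg_oplus_self, MVAlgebra.neg_neg] at this
      · rw [hf.map_neg, hf.map_oplus, hf.map_neg]
        change (0 : ℝ) < 1 - min (1 - (f y : ℝ) + f x) 1
        have : (f x : ℝ) < f y := hlt
        linarith [min_le_left (1 - (f y : ℝ) + f x) 1]
    have mult : ∀ n : ℕ, ∃ e, θ.r e zero ∧ (f e : ℝ) = min (n * (f d : ℝ)) 1 := by
      intro n
      induction n with
      | zero => exact ⟨zero, θ.refl' _, by rw [hzero]; simp⟩
      | succ n ih =>
        obtain ⟨e, he, hfe⟩ := ih
        refine ⟨oplus e d, ?_, ?_⟩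
        · have := θ.oplus_congr he hd
          rwa [oplus_zero] at this
        · rw [hf.map_oplus]
          change min ((f e : ℝ) + f d) 1 = _
          rw [hfe]
          push_cast
          rcases le_total (n * (f d : ℝ)) 1 with h | h
          · rw [min_eq_left h, add_mul, one_mul]
          · rw [min_eq_right h, min_eq_right (by linarith), min_eq_right (by linarith)]
    obtain ⟨n, hn⟩ := exists_nat_ge (1 / (f d : ℝ))
    obtain ⟨e, he, hfe⟩ := mult n
    rw [min_eq_right ((div_le_iff₀ hfd).1 hn)] at hfe
    obtain rfl : e = neg zero := hinj (Subtype.ext (by rw [hfe, hone]; rfl))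
    have all : ∀ z, θ.r (neg zero) z := by
      intro z
      have := θ.oplus_congr (θ.refl' z) he
      rwa [oplus_zero, oplus_neg_zero] at this
    exact hst (θ.trans' (θ.symm' (all s)) (all t))
  intro x y hxy
  refine hinj (le_antisymm ?_ ?_)
  · exact not_lt.1 fun h => key y x h (θ.symm' hxy)
  · exact not_lt.1 fun h => key x y h hxy

/-- The quotient of an MV-algebra by a congruence. -/
instance {A : Type u} [MVAlgebra A] (θ : MVCongruence A) : MVAlgebra (Quotient θ.toSetoid) where
  oplus := Quotient.map₂ oplus fun _ _ h _ _ h' => θ.oplus_congr h h'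
  zero := Quotient.mk _ zero
  neg := Quotient.map neg fun _ _ h => θ.neg_congr h
  oplus_assoc := by
    rintro ⟨x⟩ ⟨y⟩ ⟨z⟩
    exact congrArg (Quotient.mk _) (oplus_assoc x y z)
  oplus_comm := by
    rintro ⟨x⟩ ⟨y⟩
    exact congrArg (Quotient.mk _) (oplus_comm x y)
  oplus_zero := by
    rintro ⟨x⟩
    exact congrArg (Quotient.mk _) (oplus_zero x)
  neg_neg := by
    rintro ⟨x⟩
    exact congrArg (Quotient.mk _) (MVAlgebra.neg_neg x)
  oplus_neg_zero := by
    rintro ⟨x⟩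
    exact congrArg (Quotient.mk _) (oplus_neg_zero x)
  lukasiewicz := by
    rintro ⟨x⟩ ⟨y⟩
    exact congrArg (Quotient.mk _) (lukasiewicz x y)

/-- The kernel congruence of a homomorphism. -/
def IsMVHom.ker {A : Type u} {B : Type v} [MVAlgebra A] [MVAlgebra B] {f : A → B}
    (hf : IsMVHom f) : MVCongruence A where
  toSetoid := Setoid.ker f
  oplus_congr {x x' y y'} h h' := by
    have h : f x = f x' := h
    have h' : f y = f y' := h'
    change f _ = f _
    rw [hf.map_oplus, hf.map_oplus, h, h']
  neg_congr {x x'} h := by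
    have h : f x = f x' := h
    change f _ = f _
    rw [hf.map_neg, hf.map_neg, h]

theorem IsMVHom.equiv_symm {A : Type u} {B : Type v} [MVAlgebra A] [MVAlgebra B] {e : A ≃ B}
    (he : IsMVHom e) : IsMVHom e.symm where
  map_zero := by rw [Equiv.symm_apply_eq, he.map_zero]
  map_oplus x y := by
    rw [Equiv.symm_apply_eq, he.map_oplus, e.apply_symm_apply, e.apply_symm_apply]
  map_neg x := by rw [Equiv.symm_apply_eq, he.map_neg, e.apply_symm_apply]

/-- Each quotient by a kernel embeds in `[0,1]`, hence is simple. Quotients, rather than `[0,1]`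
itself, make the components surjective and stay in the universe of `A`. -/
theorem isSemisimpleMV_of_separating {A : Type u} [MVAlgebra A] {ι : Type u}
    (f : ι → A → unitInterval) (hf : ∀ i, IsMVHom (f i))
    (hsep : ∀ a b, (∀ i, f i a = f i b) → a = b) : IsSemisimpleMV A := by
  refine ⟨ι, fun i => Quotient (hf i).ker.toSetoid, fun i => inferInstance,
    fun i a => Quotient.mk _ a, fun i => ?_, fun i => ⟨rfl, fun _ _ => rfl, fun _ => rfl⟩,
    fun i => Quotient.mk_surjective, ?_⟩
  · refine isSimpleMV_of_injective (f := Quotient.lift (f i) fun _ _ h => h) ⟨?_, ?_, ?_⟩ ?_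
    · exact (hf i).map_zero
    · rintro ⟨x⟩ ⟨y⟩
      exact (hf i).map_oplus x y
    · rintro ⟨x⟩
      exact (hf i).map_neg x
    · rintro ⟨x⟩ ⟨y⟩ h
      exact Quotient.sound h
  · intro a b h
    exact hsep a b fun i => Quotient.exact (congrFun h i)

section ZFunAlgebra

variable {I : Type v} {X : Set (I → unitInterval)}

theorem isMVHom_eval (x : X) :
    IsMVHom (fun g : {ξ : X → unitInterval // IsZFun ξ} => g.1 x) :=
  ⟨rfl, fun _ _ => rfl, fun _ => rfl⟩

end ZFunAlgebra

theorem semisimple_McN (X : TychSub.{u}ᵒᵖ) : semisimple (McN.obj X) := by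
  refine isSemisimpleMV_of_separating (ι := ULift.{u} X.unop.space) (A := (McN.obj X).carrier)
    (fun x g => g.1 x.down) (fun x => isMVHom_eval x.down) ?_
  intro a b h
  exact Subtype.ext (funext fun x => h ⟨x⟩)

/-! ### The units -/

section Units

variable (A : Type u) [MVAlgebra A]

/-- Evaluation of the elements of an MV-algebra at its `[0,1]`-valued homomorphisms. -/
def evalElement (a : A) : {ξ : homSet A → unitInterval // IsZFun ξ} :=
  ⟨fun f => f.1 a, isZFun_proj a⟩

theorem isMVHom_evalElement : IsMVHom (evalElement A) where
  map_zero := Subtype.ext (funext fun f => f.2.map_zero)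
  map_oplus x y := Subtype.ext (funext fun f => f.2.map_oplus x y)
  map_neg x := Subtype.ext (funext fun f => f.2.map_neg x)

variable {A} in
theorem IsSemisimpleMV.evalElement_injective (hA : IsSemisimpleMV A) :
    Function.Injective (evalElement A) := by
  intro a b h
  by_contra hab
  obtain ⟨f, hf, hne⟩ := hA.exists_hom_ne hab
  exact hne (congrFun (congrArg Subtype.val h) ⟨f, hf⟩)

/-- The functions on `homSet A` represented by elements of `A` are closed under the MV-operations
and contain the coordinates, so McNaughton's theorem applies. Semisimplicity plays no role here,
only in injectivity. -/
theorem evalElement_surjective : Function.Surjective (evalElement A) := by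
  rintro ⟨ξ, f, hf, hξ⟩
  have hP : IsMVClosed fun g : homSet A → unitInterval => ∃ a, ∀ φ : homSet A, φ.1 a = g φ :=
    { zero := ⟨zero, fun φ => φ.2.map_zero⟩
      oplus := by
        rintro g g' ⟨a, ha⟩ ⟨b, hb⟩
        exact ⟨oplus a b, fun φ => by rw [φ.2.map_oplus, ha, hb]; rfl⟩
      neg := by
        rintro g ⟨a, ha⟩
        exact ⟨neg a, fun φ => by rw [φ.2.map_neg, ha]; rfl⟩ }
  obtain ⟨a, ha⟩ := hP.of_isIntPL (x := fun a φ => φ.1 a) (fun a => ⟨a, fun _ => rfl⟩) hf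
  exact ⟨a, Subtype.ext (funext fun φ => (ha φ).trans (hξ φ).symm)⟩

end Units

/-! ### Recovering a closed subspace from its algebra of functions -/

section Counit

variable {I : Type v}

theorem isMVClosed_isIntPL : IsMVClosed fun f : (I → unitInterval) → unitInterval => IsIntPL f where
  zero := isIntPL_zero
  oplus {f g} hf hg := by
    simpa using isIntPL_truncAdd.comp (g := fun b => cond b f g) (by rintro (_ | _) <;> assumption)
  neg {f} hf := isIntPL_symm.comp (g := fun _ => f) fun _ => hf

/-- A point is separated from a closed subset of a cube by a piecewise linear map with integer
coefficients. -/
theorem exists_isIntPL_separating {X : Set (I → unitInterval)} (hX : IsClosed X)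
    {p : I → unitInterval} (hp : p ∉ X) :
    ∃ f : (I → unitInterval) → unitInterval, IsIntPL f ∧ f p ≠ 0 ∧ ∀ x ∈ X, f x = 0 := by
  have hU : Xᶜ ∈ nhds p := hX.isOpen_compl.mem_nhds hp
  rw [nhds_pi, Filter.mem_pi] at hU
  obtain ⟨s, hs, t, ht, hst⟩ := hU
  have bump : ∀ i, ∃ f : unitInterval → unitInterval,
      IsIntPL (fun x : I → unitInterval => f (x i)) ∧ f (p i) ≠ 0 ∧ ∀ y ∉ t i, f y = 0 := by
    intro i
    obtain ⟨ε, hε, hball⟩ := Metric.mem_nhds_iff.1 (ht i)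
    obtain ⟨N, hN⟩ := exists_nat_gt (2 / ε)
    have hN0 : (0 : ℝ) < N := lt_trans (by positivity) hN
    have hNε : 2 < N * ε := (div_lt_iff₀ hε).1 hN
    -- The bump below is positive exactly between `(m - 1) / N` and `(m + 2) / N`. This contains `p
    -- i`, and both ends are within `2 / N < ε` of it.
    let m : ℤ := ⌊(N : ℝ) * (p i : ℝ)⌋
    have hm1 : (m : ℝ) ≤ N * p i := Int.floor_le _
    have hm2 : (N : ℝ) * p i < m + 1 := Int.lt_floor_add_one _
    refine ⟨fun y => clamp (N * y + (1 - m : ℤ)) ⊓ clamp (-(N * (y : ℝ)) + (m + 2 : ℤ)), ?_, ?_, ?_⟩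
    · have h : ∀ c : ℤ, IsIntPL fun x : I → unitInterval => clamp ((N : ℝ) * (x i : ℝ) + c) := by
        intro c
        have := isMVClosed_isIntPL.clamp_affine (x := fun (_ : Unit) (x : I → unitInterval) => x i)
          (fun _ => isIntPL_proj i) (c, fun _ => (N : ℤ))
        simpa [affineVal, add_comm] using this
      exact isMVClosed_isIntPL.inf (h _) (isMVClosed_isIntPL.clamp_neg h _)
    · have h : ∀ r : ℝ, 0 < r → clamp r ≠ 0 := by
        intro r hr h0
        have : max 0 (min 1 r) = 0 := congrArg Subtype.val h0
        have : (0 : ℝ) < max 0 (min 1 r) := lt_max_of_lt_right (lt_min one_pos hr)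
        linarith
      rcases min_choice (clamp (N * (p i : ℝ) + (1 - m : ℤ)))
        (clamp (-(N * (p i : ℝ)) + (m + 2 : ℤ))) with e | e
      · exact fun h0 => h _ (by push_cast; linarith) (e.symm.trans h0)
      · exact fun h0 => h _ (by push_cast; linarith) (e.symm.trans h0)
    · intro y hy
      have hd : ε ≤ |(y : ℝ) - p i| := not_lt.1 fun h => hy (hball h)
      have h0 : ∀ r : ℝ, r ≤ 0 → clamp r = 0 := fun r hr => Set.projIcc_of_le_left _ hr
      rcases le_abs.1 hd with h | h
      · refine le_antisymm (inf_le_right.trans (h0 _ ?_).le) unitInterval.nonneg'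
        push_cast
        nlinarith
      · refine le_antisymm (inf_le_left.trans (h0 _ ?_).le) unitInterval.nonneg'
        push_cast
        nlinarith
  choose f hf hfp hft using bump
  -- Finitely many coordinates define the basic neighbourhood, so a finite minimum suffices. The
  -- empty minimum is `1`; in that case `X` is empty.
  refine ⟨fun x => hs.toFinset.inf fun i => f i (x i),
    isMVClosed_isIntPL.finset_inf _ fun i _ => hf i, ?_, ?_⟩
  · have : 0 < hs.toFinset.inf fun i => f i (p i) :=
      (Finset.lt_inf_iff (show (0 : unitInterval) < ⊤ from zero_lt_one)).2 fun i _ =>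
        unitInterval.pos_iff_ne_zero.2 (hfp i)
    exact this.ne'
  · intro x hx
    have : ¬ x ∈ s.pi t := fun h => hst h hx
    simp only [Set.mem_pi, not_forall] at this
    obtain ⟨i, hi, hxi⟩ := this
    refine le_antisymm ?_ unitInterval.nonneg'
    rw [← hft i _ hxi]
    exact Finset.inf_le (hs.mem_toFinset.2 hi)

variable (X : Set (I → unitInterval))

/-- Evaluation of the `ℤ`-maps on `X` at the points of `X`. -/
def evalPoint (x : X) : homSet {ξ : X → unitInterval // IsZFun ξ} :=
  ⟨fun g => g.1 x, isMVHom_eval x⟩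

theorem isZMap_evalPoint : IsZMap (evalPoint X) := fun g => g.2

variable {X}

/-- The maps `g` on the whole cube that satisfy this identity are closed under the MV-operations and
contain the coordinates. Working on the cube allows evaluation at the point defined by `φ` before it
is known to lie in `X`. -/
theorem hom_apply_eq (φ : homSet {ξ : X → unitInterval // IsZFun ξ})
    {f : (I → unitInterval) → unitInterval} (hf : IsIntPL f) :
    φ.1 ⟨fun x => f x, f, hf, fun _ => rfl⟩ = f fun i => φ.1 ⟨_, isZFun_proj i⟩ := by
  have hP : IsMVClosed fun g : (I → unitInterval) → unitInterval =>
      ∃ h : IsZFun (fun x : X => g x), φ.1 ⟨_, h⟩ = g fun i => φ.1 ⟨_, isZFun_proj i⟩ :=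
    { zero := ⟨isZFun_zero, φ.2.map_zero⟩
      oplus := by
        rintro g g' ⟨h, e⟩ ⟨h', e'⟩
        refine ⟨h.truncAdd h', (φ.2.map_oplus ⟨_, h⟩ ⟨_, h'⟩).trans ?_⟩
        rw [e, e']
        rfl
      neg := by
        rintro g ⟨h, e⟩
        refine ⟨h.symm, (φ.2.map_neg ⟨_, h⟩).trans ?_⟩
        rw [e]
        rfl }
  obtain ⟨_, e⟩ := hP.of_isIntPL (x := fun i x => x i) (fun i => ⟨isZFun_proj i, rfl⟩) hf
  exact e

/-- A separating map restricts to zero on `X`, so `φ` sends it to `0`; but `φ` also sends it to its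
nonzero value at the point. -/
theorem hom_proj_mem (hX : IsClosed X) (φ : homSet {ξ : X → unitInterval // IsZFun ξ}) :
    (fun i => φ.1 ⟨_, isZFun_proj i⟩) ∈ X := by
  by_contra hp
  obtain ⟨f, hf, hne, h0⟩ := exists_isIntPL_separating hX hp
  rw [← hom_apply_eq φ hf] at hne
  refine hne (Eq.trans (congrArg φ.1 ?_) φ.2.map_zero)
  exact Subtype.ext (funext fun x => h0 x x.2)

/-- The point of a closed subspace at which a given homomorphism is the evaluation. -/
def homPoint (hX : IsClosed X) (φ : homSet {ξ : X → unitInterval // IsZFun ξ}) : X :=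
  ⟨_, hom_proj_mem hX φ⟩

theorem isZMap_homPoint (hX : IsClosed X) : IsZMap (homPoint hX) := fun i =>
  isZFun_proj (P := homSet {ξ : X → unitInterval // IsZFun ξ}) ⟨_, isZFun_proj i⟩

theorem evalPoint_homPoint (hX : IsClosed X) (φ : homSet {ξ : X → unitInterval // IsZFun ξ}) :
    evalPoint X (homPoint hX φ) = φ := by
  refine Subtype.ext (funext fun ⟨ξ, f, hf, hξ⟩ => ?_)
  obtain rfl : ξ = fun x : X => f x := funext hξ
  exact (hom_apply_eq φ hf).symm

end Counit

/-! ### The dual equivalence -/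

/-- The evaluation maps `A → McN(W(A))`. -/
def dualityUnit : 𝟭 MVS.{u} ⟶ WS ⋙ McNS semisimple_McN where
  app A := ⟨⟨evalElement A.obj.carrier, isMVHom_evalElement _⟩⟩
  naturality _ _ _ := rfl

/-- The evaluation maps `X → W(McN(X))`. -/
def dualityCounit : McNS semisimple_McN ⋙ WS ⟶ 𝟭 TychSub.{u}ᵒᵖ where
  app X := Quiver.Hom.op (X := X.unop)
    (Y := ⟨_, homSet {ξ : X.unop.space → unitInterval // IsZFun ξ}, isClosed_homSet _⟩)
    ⟨evalPoint X.unop.space, isZMap_evalPoint _⟩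
  naturality _ _ _ := rfl

/-- The contravariant adjunction between `W` and `McN`. -/
def dualityAdjunction : WS.{u} ⊣ McNS semisimple_McN :=
  Adjunction.mkOfUnitCounit
    { unit := dualityUnit
      counit := dualityCounit
      -- Both triangle identities say that evaluating an evaluation returns the original value.
      left_triangle := rfl
      right_triangle := rfl }

instance (A : MVS.{u}) : IsIso (dualityUnit.app A) := by
  let e := Equiv.ofBijective (evalElement A.obj.carrier)
    ⟨IsSemisimpleMV.evalElement_injective A.property, evalElement_surjective _⟩
  have he : IsMVHom e := isMVHom_evalElement _
  refine ⟨⟨⟨e.symm, he.equiv_symm⟩⟩, ?_, ?_⟩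
  · exact ObjectProperty.hom_ext _ (MVAlg.Hom.ext (funext e.symm_apply_apply))
  · exact ObjectProperty.hom_ext _ (MVAlg.Hom.ext (funext e.apply_symm_apply))

instance (X : TychSub.{u}ᵒᵖ) : IsIso (dualityCounit.app X) := by
  refine ⟨Quiver.Hom.op (Y := X.unop)
    (X := ⟨_, homSet {ξ : X.unop.space → unitInterval // IsZFun ξ}, isClosed_homSet _⟩)
    ⟨homPoint X.unop.isClosed, isZMap_homPoint _⟩, ?_, ?_⟩
  · exact Quiver.Hom.unop_inj (TychSub.Hom.ext (funext (evalPoint_homPoint X.unop.isClosed)))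
  · rfl

end MVDuality

theorem mainTheorem1 :
    ∃ (hM : ∀ X : TychSub.{u}ᵒᵖ, semisimple (McN.obj X)) (adj : WS.{u} ⊣ McNS hM),
      -- the unit at `A` is the evaluation `A → McN(W(A))`, `a ↦ (f ↦ f a)`
      (∀ (A : MVS.{u}) (a : A.obj.carrier) (f : homSet A.obj.carrier),
        ((adj.unit.app A).hom.toFun a).1 f = f.1 a) ∧
      -- the counit at `X` is the evaluation `X → W(McN(X))`, `x ↦ (g ↦ g x)`
      (∀ (X : TychSub.{u}) (x : X.space) (g : {ξ : X.space → unitInterval // IsZFun ξ}),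
        ((adj.counit.app (op X)).unop.toFun x).1 g = g.1 x) ∧
      IsIso adj.unit ∧ IsIso adj.counit ∧
      (WS.{u}).IsEquivalence ∧ (McNS hM).IsEquivalence := by
  have hu : ∀ A, IsIso (dualityAdjunction.{u}.unit.app A) := fun A =>
    inferInstanceAs (IsIso (dualityUnit.app A))
  have hc : ∀ X, IsIso (dualityAdjunction.{u}.counit.app X) := fun X =>
    inferInstanceAs (IsIso (dualityCounit.app X))
  refine ⟨semisimple_McN, dualityAdjunction, fun _ _ _ => rfl, fun _ _ _ => rfl,
    NatIso.isIso_of_isIso_app _, NatIso.isIso_of_isIso_app _, ?_, ?_⟩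
  · exact dualityAdjunction.toEquivalence.isEquivalence_functor
  · exact dualityAdjunction.toEquivalence.isEquivalence_inverse
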